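/- Let $\mathbb{T}$ be the set of isomorphism classes of finite rooted trees. For $t\in\mathbb{T}$ let $V(t)$ and $E(t)$ be its sets of vertices and edges, $|t|=|V(t)|$, and let the root degree $\mathrm{rdeg}(t)$ be the number of edges at the root. For $v\in V(s)$ let $s\cup_v t$ be the tree obtained by joining the root of $t$ to the vertex $v$ of $s$ by a new edge (rooted at the root of $s$). Removing $e\in E(t)$ splits $t$ into the part $R_e(t)$ containing the root and the branch $P_e(t)$. Put $$\alpha(t_1,t_2,t_3)=|\{e\in E(t_2): R_e(t_2)=t_3,\ P_e(t_2)=t_1\}|,\qquad \beta(t_1,t_2,t_3)=|\{v\in V(t_3): t_1=t_3\cup_v t_2\}|.$$ The insertion-elimination algebra $\mathfrak{g}$ is the complex Lie algebra with basis $\{d\}\cup\{D_t^{+},D_t^{-} : t\in\mathbb{T}\}$ and brackets $$[D_s^+,D_t^+]=\sum_{r}(\beta(r,s,t)-\beta(r,t,s))D_r^+,\qquad [D_s^-,D_t^-]=\sum_{r}(\alpha(t,r,s)-\alpha(s,r,t))D_r^-,$$ $$[D_s^-,D_t^+]=\sum_{r}\alpha(s,t,r)D_r^+ +\sum_{r}\beta(s,t,r)D_r^-\quad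 (s\neq t),\qquad [D_t^-,D_t^+]=d,$$ $$[d,D_t^-]=-|t|D_t^-,\qquad [d,D_t^+]=|t|D_t^+ ,$$ where all sums run over $r\in\mathbb{T}$ (and have finitely many nonzero terms). Let $\mathfrak{n}^+\subseteq\mathfrak{g}$ be the subalgebra spanned by the $D_t^+$. For a Lie algebra homomorphism $\eta:\mathfrak{n}^+\to\mathbb{C}$ let $\mathbb{C}_\eta$ be the one-dimensional $\mathfrak{n}^+$-module on which $x$ acts by $\eta(x)$, and let $M_\eta=U(\mathfrak{g})\otimes_{U(\mathfrak{n}^+)}\mathbb{C}_\eta$ be the standard Whittaker module. A Whittaker vector of type $\eta$ in $M_\eta$ is a vector $v$ with $xv=\eta(x)v$ for all $x\in\mathfrak{n}^+$. The homomorphism $\eta$ is root-bounded if there is a positive integer $M$ such that $\eta(D_t^+)=0$ whenever $\mathrm{rdeg}(t)\ge M$. **Theorem.** Let $\eta:\mathfrak{n}^+\to\mathbb{C}$ be a nonzero root-bounded Lie algebra homomorphism. Then the space of Whittaker vectors of type $\eta$ in $M_\eta$ is one-dimensional, and $M_\eta$ is a simple $\mathfrak{g}$-module. -/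

import Mathlib

attribute [local instance 100] LieRing.ofAssociativeRing

namespace InsElim

/-! ### Rooted trees -/

/-- Finite rooted trees in which the children of every vertex are listed in some order:
`leaf` is the one-vertex tree, and `graft a b` is obtained from the disjoint union of `a` and `b` by
joining the root of `b` to the root of `a` by a new edge; its root is the root of `a`, and `b`
becomes the last child of that root. -/
inductive PlaneTree : Type
  | leaf : PlaneTree
  | graft : PlaneTree → PlaneTree → PlaneTree

namespace PlaneTree

/-- The vertex set `V(t)`. -/
def Vert : PlaneTree → Type
  | leaf => Unit
  | graft a b => Vert a ⊕ Vert b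

/-- The edge set `E(t)`; `Sum.inr (Sum.inl ())` is the new edge of `graft a b`. -/
def Edge : PlaneTree → Type
  | leaf => Empty
  | graft a b => Edge a ⊕ (Unit ⊕ Edge b)

/-- `V(t)` is finite. -/
instance fintypeVert : (t : PlaneTree) → Fintype (Vert t)
  | leaf => inferInstanceAs (Fintype Unit)
  | graft a b =>
      letI := fintypeVert a
      letI := fintypeVert b
      inferInstanceAs (Fintype (Vert a ⊕ Vert b))

/-- `E(t)` is finite. -/
instance fintypeEdge : (t : PlaneTree) → Fintype (Edge t)
  | leaf => inferInstanceAs (Fintype Empty)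
  | graft a b =>
      letI := fintypeEdge a
      letI := fintypeEdge b
      inferInstanceAs (Fintype (Edge a ⊕ (Unit ⊕ Edge b)))

/-- `|t|`, the number of vertices. -/
def size (t : PlaneTree) : ℕ := Fintype.card (Vert t)

/-- The root degree: the number of edges at the root (that is, of children of the root). -/
def rdeg : PlaneTree → ℕ
  | leaf => 0
  | graft a _ => rdeg a + 1

/-- `s ∪_v t`: join the root of `t` to the vertex `v` of `s` by a new edge. -/
def attach : (s : PlaneTree) → Vert s → PlaneTree → PlaneTree
  | leaf, _, t => graft leaf t
  | graft a b, Sum.inl v, t => graft (attach a v t) b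
  | graft a b, Sum.inr v, t => graft a (attach b v t)

/-- `R_e(t)`: the part containing the root that remains after removing the edge `e`. -/
def rootPart : (t : PlaneTree) → Edge t → PlaneTree
  | graft a b, Sum.inl e => graft (rootPart a e) b
  | graft a _, Sum.inr (Sum.inl _) => a
  | graft a b, Sum.inr (Sum.inr e) => graft a (rootPart b e)

/-- `P_e(t)`: the branch that is cut off by removing the edge `e`. -/
def branchPart : (t : PlaneTree) → Edge t → PlaneTree
  | graft a _, Sum.inl e => branchPart a e
  | graft _ b, Sum.inr (Sum.inl _) => b
  | graft _ b, Sum.inr (Sum.inr e) => branchPart b e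

/-- Isomorphism of rooted trees: two trees are isomorphic when one is obtained from the other by
reordering the children of vertices, i.e. by a succession of exchanges of two neighbouring
children of a vertex. -/
inductive Iso : PlaneTree → PlaneTree → Prop
  | refl (a) : Iso a a
  | symm {a b} : Iso a b → Iso b a
  | trans {a b c} : Iso a b → Iso b c → Iso a c
  | graft {a a' b b'} : Iso a a' → Iso b b' → Iso (graft a b) (graft a' b')
  | swap (a b c) : Iso (PlaneTree.graft (PlaneTree.graft a b) c)
      (PlaneTree.graft (PlaneTree.graft a c) b)

/-- Isomorphism as an equivalence relation. -/
instance isoSetoid : Setoid PlaneTree := ⟨Iso, Iso.refl, Iso.symm, Iso.trans⟩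

theorem size_leaf : size leaf = 1 := rfl

theorem size_graft (a b : PlaneTree) : size (graft a b) = size a + size b :=
  Fintype.card_sum (α := Vert a) (β := Vert b)

theorem size_eq_of_iso {a b : PlaneTree} (h : Iso a b) : size a = size b := by
  induction h with
  | refl => rfl
  | symm _ ih => exact ih.symm
  | trans _ _ ih₁ ih₂ => exact ih₁.trans ih₂
  | graft _ _ ih₁ ih₂ => rw [size_graft, size_graft, ih₁, ih₂]
  | swap => simp only [size_graft]; omega

theorem rdeg_eq_of_iso {a b : PlaneTree} (h : Iso a b) : rdeg a = rdeg b := by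
  induction h with
  | refl => rfl
  | symm _ ih => exact ih.symm
  | trans _ _ ih₁ ih₂ => exact ih₁.trans ih₂
  | graft _ _ ih₁ ih₂ => simp only [rdeg, ih₁]
  | swap => simp only [rdeg]

end PlaneTree

/-- `𝕋`: the set of (isomorphism classes of) finite rooted trees. -/
def RTree : Type := Quotient PlaneTree.isoSetoid

namespace RTree

/-- The isomorphism class of a tree. -/
def mk (p : PlaneTree) : RTree := Quotient.mk _ p

/-- A representative of an isomorphism class. -/
noncomputable def rep (t : RTree) : PlaneTree := Quotient.out t

/-- `|t|`, the number of vertices. -/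
def size (t : RTree) : ℕ := Quotient.lift PlaneTree.size (fun _ _ => PlaneTree.size_eq_of_iso) t

/-- The root degree. -/
def rdeg (t : RTree) : ℕ := Quotient.lift PlaneTree.rdeg (fun _ _ => PlaneTree.rdeg_eq_of_iso) t

open Classical in
/-- `α(t₁, t₂, t₃) = |{e ∈ E(t₂) : R_e(t₂) = t₃, P_e(t₂) = t₁}|`. -/
noncomputable def alpha (t₁ t₂ t₃ : RTree) : ℕ :=
  Fintype.card {e : t₂.rep.Edge // mk (t₂.rep.rootPart e) = t₃ ∧ mk (t₂.rep.branchPart e) = t₁}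

open Classical in
/-- `β(t₁, t₂, t₃) = |{v ∈ V(t₃) : t₁ = t₃ ∪_v t₂}|`. -/
noncomputable def beta (t₁ t₂ t₃ : RTree) : ℕ :=
  Fintype.card {v : t₃.rep.Vert // t₁ = mk (t₃.rep.attach v t₂.rep)}

end RTree

/-! ### The insertion-elimination Lie algebra -/

/-- Labels of the basis `{d} ∪ {D_t⁺ : t ∈ 𝕋} ∪ {D_t⁻ : t ∈ 𝕋}`. -/
inductive Index : Type
  | d : Index
  | plus : RTree → Index
  | minus : RTree → Index

/-- The complex vector space `𝔤` with basis `{d} ∪ {D_t⁺} ∪ {D_t⁻}`. -/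
def Alg : Type := Index →₀ ℂ

noncomputable instance : AddCommGroup Alg := inferInstanceAs (AddCommGroup (Index →₀ ℂ))

noncomputable instance : Module ℂ Alg := inferInstanceAs (Module ℂ (Index →₀ ℂ))

/-- The defining basis of `𝔤`. -/
noncomputable def basis : Module.Basis Index ℂ Alg := Module.Basis.ofRepr (LinearEquiv.refl ℂ (Index →₀ ℂ))

/-- The basis vector `d`. -/
noncomputable def dd : Alg := basis Index.d

/-- The basis vector `D_t⁺`. -/
noncomputable def Dp (t : RTree) : Alg := basis (Index.plus t)

/-- The basis vector `D_t⁻`. -/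
noncomputable def Dm (t : RTree) : Alg := basis (Index.minus t)

open Classical in
/-- `[D_s⁻, D_t⁺]`. All the sums below have only finitely many nonzero terms. -/
noncomputable def brMP (s t : RTree) : Alg :=
  if s = t then dd
  else ∑ᶠ r : RTree, (RTree.alpha s t r : ℂ) • Dp r + ∑ᶠ r : RTree, (RTree.beta s t r : ℂ) • Dm r

/-- The brackets of the basis vectors. -/
noncomputable def brBasis : Index → Index → Alg
  | .d, .d => 0
  | .d, .plus t => (t.size : ℂ) • Dp t
  | .d, .minus t => -((t.size : ℂ) • Dm t)
  | .plus t, .d => -((t.size : ℂ) • Dp t)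
  | .minus t, .d => (t.size : ℂ) • Dm t
  | .plus s, .plus t => ∑ᶠ r : RTree, ((RTree.beta r s t : ℂ) - (RTree.beta r t s : ℂ)) • Dp r
  | .minus s, .minus t => ∑ᶠ r : RTree, ((RTree.alpha t r s : ℂ) - (RTree.alpha s r t : ℂ)) • Dm r
  | .minus s, .plus t => brMP s t
  | .plus t, .minus s => -brMP s t

/-- The bilinear extension of `brBasis`. -/
noncomputable def br : Alg →ₗ[ℂ] Alg →ₗ[ℂ] Alg :=
  basis.constr ℂ fun i => basis.constr ℂ fun j => brBasis i j

noncomputable instance : Bracket Alg Alg := ⟨fun x y => br x y⟩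

theorem br_basis (i j : Index) : br (basis i) (basis j) = brBasis i j := by
  simp [br]

/-! ### The action on trees by insertion and elimination

This action is faithful; it is used to verify the Jacobi identity. -/

/-- The vector space with basis `𝕋`. -/
abbrev Tr : Type := RTree →₀ ℂ

namespace RTree

/-- `graft` on isomorphism classes. -/
def graft (a b : RTree) : RTree :=
  Quotient.map₂ PlaneTree.graft (fun _ _ h _ _ h' => PlaneTree.Iso.graft h h') a b

/-- The one-vertex tree. -/
def leaf : RTree := mk PlaneTree.leaf

theorem mk_graft (a b : PlaneTree) : mk (PlaneTree.graft a b) = graft (mk a) (mk b) := rfl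

theorem mk_rep (t : RTree) : mk t.rep = t := Quotient.out_eq t

theorem mk_eq {a b : PlaneTree} (h : PlaneTree.Iso a b) : mk a = mk b := Quotient.sound h

theorem ind {P : RTree → Prop} (h0 : P leaf) (h : ∀ a b, P a → P b → P (graft a b)) (t : RTree) :
    P t := by
  induction t using Quotient.inductionOn with
  | h p =>
    induction p with
    | leaf => exact h0
    | graft a b iha ihb => exact h _ _ iha ihb

theorem graft_swap (a b c : RTree) : graft (graft a b) c = graft (graft a c) b := by
  induction a using Quotient.inductionOn
  induction b using Quotient.inductionOn
  induction c using Quotient.inductionOn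
  exact Quotient.sound (PlaneTree.Iso.swap _ _ _)

theorem size_leaf : leaf.size = 1 := rfl

theorem size_graft (a b : RTree) : (graft a b).size = a.size + b.size := by
  induction a using Quotient.inductionOn
  induction b using Quotient.inductionOn
  exact PlaneTree.size_graft _ _

theorem size_pos (t : RTree) : 0 < t.size := by
  induction t using ind with
  | h0 => rw [size_leaf]; exact one_pos
  | h a b iha ihb => rw [size_graft]; omega

theorem size_mk (p : PlaneTree) : (mk p).size = p.size := rfl

theorem finite_size_le (n : ℕ) : {t : RTree | t.size ≤ n}.Finite := by
  induction n with
  | zero =>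
    convert Set.finite_empty
    ext t
    have := t.size_pos
    simp only [Set.mem_ofPred_eq, Set.mem_empty_iff_false, iff_false]
    omega
  | succ n ih =>
    refine ((Set.Finite.image2 graft ih ih).union (Set.finite_singleton leaf)).subset ?_
    intro t
    induction t using ind with
    | h0 => intro _; exact Or.inr rfl
    | h a b _ _ =>
      intro h
      have ha := a.size_pos
      have hb := b.size_pos
      simp only [Set.mem_ofPred_eq, size_graft] at h
      refine Or.inl ⟨a, ?_, b, ?_, rfl⟩ <;> simp only [Set.mem_ofPred_eq] <;> omega

end RTree

open RTree in
/-- The bilinear extension of `graft`. -/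
noncomputable def gr : Tr →ₗ[ℂ] Tr →ₗ[ℂ] Tr :=
  Finsupp.lsum ℂ fun a => LinearMap.toSpanSingleton ℂ _ (Finsupp.lmapDomain ℂ ℂ (graft a))

/-- The basis vector of `Tr` given by a tree. -/
noncomputable abbrev e (t : RTree) : Tr := Finsupp.single t 1

theorem gr_single (a b : RTree) : gr (e a) (e b) = e (RTree.graft a b) := by
  simp [gr, e]

theorem gr_swap (x y z : Tr) : gr (gr x y) z = gr (gr x z) y := by
  induction x using Finsupp.induction_linear with
  | zero => simp
  | add f g hf hg => simp [hf, hg]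
  | single a r =>
  induction y using Finsupp.induction_linear with
  | zero => simp
  | add f g hf hg => simp [hf, hg]
  | single b r' =>
  induction z using Finsupp.induction_linear with
  | zero => simp
  | add f g hf hg => simp [hf, hg]
  | single c r'' =>
    have h : ∀ (t : RTree) (q : ℂ), Finsupp.single t q = q • e t := by intro t q; simp [e]
    rw [h, h, h]
    simp only [map_smul, LinearMap.smul_apply, gr_single, RTree.graft_swap a b c]
    rw [smul_comm r'' r']

/-- Insertion, on representatives. -/
noncomputable def insP (q p : PlaneTree) : Tr := ∑ v : p.Vert, e (RTree.mk (p.attach v q))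

/-- Elimination, on representatives. -/
noncomputable def elimP (s : RTree) (p : PlaneTree) : Tr := by
  classical
  exact ∑ x : p.Edge, if RTree.mk (p.branchPart x) = s then e (RTree.mk (p.rootPart x)) else 0

theorem insP_leaf (q : PlaneTree) :
    insP q PlaneTree.leaf = gr (e RTree.leaf) (e (RTree.mk q)) := by
  rw [gr_single]
  exact Fintype.sum_unique (ι := Unit) _

theorem insP_graft (q a b : PlaneTree) :
    insP q (PlaneTree.graft a b) =
      gr (insP q a) (e (RTree.mk b)) + gr (e (RTree.mk a)) (insP q b) := by
  unfold insP
  rw [map_sum, LinearMap.sum_apply, map_sum]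
  simp only [gr_single, ← RTree.mk_graft]
  exact Fintype.sum_sum_type (α₁ := a.Vert) (α₂ := b.Vert) _

theorem elimP_leaf (s : RTree) : elimP s PlaneTree.leaf = 0 :=
  Fintype.sum_empty (ι := Empty) _

open Classical in
theorem elimP_graft (s : RTree) (a b : PlaneTree) :
    elimP s (PlaneTree.graft a b) =
      gr (elimP s a) (e (RTree.mk b)) + gr (e (RTree.mk a)) (elimP s b)
        + if RTree.mk b = s then e (RTree.mk a) else 0 := by
  have h : elimP s (PlaneTree.graft a b) =
      (∑ x : a.Edge, if RTree.mk (a.branchPart x) = s then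
          e (RTree.mk (PlaneTree.graft (a.rootPart x) b)) else 0) +
      ((if RTree.mk b = s then e (RTree.mk a) else 0) +
      ∑ x : b.Edge, if RTree.mk (b.branchPart x) = s then
          e (RTree.mk (PlaneTree.graft a (b.rootPart x))) else 0) := by
    refine (Fintype.sum_sum_type (α₁ := a.Edge) (α₂ := Unit ⊕ b.Edge) _).trans ?_
    congr 1
    refine (Fintype.sum_sum_type (α₁ := Unit) (α₂ := b.Edge) _).trans ?_
    congr 1
    exact Fintype.sum_unique (ι := Unit) _
  rw [h]
  unfold elimP
  rw [map_sum, LinearMap.sum_apply, map_sum]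
  have h1 : ∀ x : a.Edge,
      gr (if RTree.mk (a.branchPart x) = s then e (RTree.mk (a.rootPart x)) else 0)
        (e (RTree.mk b)) = if RTree.mk (a.branchPart x) = s then
          e (RTree.mk (PlaneTree.graft (a.rootPart x) b)) else 0 := by
    intro x; split_ifs <;> simp only [gr_single, ← RTree.mk_graft, map_zero, LinearMap.zero_apply]
  have h2 : ∀ x : b.Edge,
      gr (e (RTree.mk a))
        (if RTree.mk (b.branchPart x) = s then e (RTree.mk (b.rootPart x)) else 0)
        = if RTree.mk (b.branchPart x) = s then
          e (RTree.mk (PlaneTree.graft a (b.rootPart x))) else 0 := by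
    intro x; split_ifs <;> simp only [gr_single, ← RTree.mk_graft, map_zero]
  simp only [h1, h2]
  abel

theorem insP_congr_left {q q' : PlaneTree} (h : RTree.mk q = RTree.mk q') (p : PlaneTree) :
    insP q p = insP q' p := by
  induction p with
  | leaf => rw [insP_leaf, insP_leaf, h]
  | graft a b iha ihb => rw [insP_graft, insP_graft, iha, ihb]

theorem insP_congr_right (q : PlaneTree) {p p' : PlaneTree} (h : PlaneTree.Iso p p') :
    insP q p = insP q p' := by
  induction h with
  | refl => rfl
  | symm _ ih => exact ih.symm
  | trans _ _ ih₁ ih₂ => exact ih₁.trans ih₂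
  | graft h₁ h₂ ih₁ ih₂ => rw [insP_graft, insP_graft, ih₁, ih₂, RTree.mk_eq h₁, RTree.mk_eq h₂]
  | swap a b c =>
    simp only [insP_graft, RTree.mk_graft, ← gr_single, map_add, LinearMap.add_apply]
    rw [gr_swap (insP q a), gr_swap _ (insP q b), gr_swap _ _ (insP q c)]
    abel

theorem elimP_congr (s : RTree) {p p' : PlaneTree} (h : PlaneTree.Iso p p') :
    elimP s p = elimP s p' := by
  induction h with
  | refl => rfl
  | symm _ ih => exact ih.symm
  | trans _ _ ih₁ ih₂ => exact ih₁.trans ih₂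
  | graft h₁ h₂ ih₁ ih₂ => rw [elimP_graft, elimP_graft, ih₁, ih₂, RTree.mk_eq h₁, RTree.mk_eq h₂]
  | swap a b c =>
    classical
    have h3 : ∀ u w : PlaneTree, gr (if RTree.mk u = s then e (RTree.mk a) else 0) (e (RTree.mk w))
        = if RTree.mk u = s then e (RTree.graft (RTree.mk a) (RTree.mk w)) else 0 := by
      intro u w; split_ifs <;> simp only [gr_single, map_zero, LinearMap.zero_apply]
    simp only [elimP_graft, map_add, LinearMap.add_apply, h3]
    simp only [RTree.mk_graft, ← gr_single]
    rw [gr_swap (elimP s a), gr_swap _ (elimP s b), gr_swap _ _ (elimP s c)]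
    abel

/-- Insertion of `t` into a tree. -/
noncomputable def ins (t u : RTree) : Tr := insP t.rep u.rep

/-- Elimination of `s` from a tree. -/
noncomputable def elim (s u : RTree) : Tr := elimP s u.rep

theorem ins_mk (t : RTree) (p : PlaneTree) : ins t (RTree.mk p) = insP t.rep p :=
  insP_congr_right _ (Quotient.exact (RTree.mk_rep (RTree.mk p)))

theorem elim_mk (s : RTree) (p : PlaneTree) : elim s (RTree.mk p) = elimP s p :=
  elimP_congr _ (Quotient.exact (RTree.mk_rep (RTree.mk p)))

theorem ins_leaf (t : RTree) : ins t RTree.leaf = gr (e RTree.leaf) (e t) := by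
  rw [RTree.leaf, ins_mk, insP_leaf, RTree.mk_rep]; rfl

theorem ins_graft (t a b : RTree) :
    ins t (RTree.graft a b) = gr (ins t a) (e b) + gr (e a) (ins t b) := by
  rw [← RTree.mk_rep a, ← RTree.mk_rep b, ← RTree.mk_graft]
  simp only [ins_mk, insP_graft]

theorem elim_leaf (s : RTree) : elim s RTree.leaf = 0 := by
  rw [RTree.leaf, elim_mk, elimP_leaf]

open Classical in
theorem elim_graft (s a b : RTree) :
    elim s (RTree.graft a b) = gr (elim s a) (e b) + gr (e a) (elim s b)
      + if b = s then e a else 0 := by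
  rw [← RTree.mk_rep a, ← RTree.mk_rep b, ← RTree.mk_graft]
  simp only [elim_mk, elimP_graft]

theorem ins_apply (t u r : RTree) : ins t u r = (RTree.beta r t u : ℂ) := by
  classical
  simp only [ins, insP, RTree.beta, Finsupp.finsetSum_apply, e, Finsupp.single_apply]
  rw [Finset.sum_boole, Fintype.card_subtype]
  simp only [eq_comm]

theorem elim_apply (s u r : RTree) : elim s u r = (RTree.alpha s u r : ℂ) := by
  classical
  simp only [elim, elimP, RTree.alpha, Finsupp.finsetSum_apply, e]
  have : ∀ x : u.rep.Edge,
      (if RTree.mk (u.rep.branchPart x) = s then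
        (Finsupp.single (RTree.mk (u.rep.rootPart x)) 1 : Tr) else 0) r =
      if (RTree.mk (u.rep.rootPart x) = r ∧ RTree.mk (u.rep.branchPart x) = s) then (1 : ℂ)
        else 0 := by
    intro x
    by_cases h : RTree.mk (u.rep.branchPart x) = s <;> simp [h, Finsupp.single_apply]
  rw [Finset.sum_congr rfl fun x _ => this x, Finset.sum_boole, Fintype.card_subtype]

theorem size_attach (p : PlaneTree) (v : p.Vert) (q : PlaneTree) :
    (p.attach v q).size = p.size + q.size := by
  induction p with
  | leaf => exact PlaneTree.size_graft _ _
  | graft a b iha ihb =>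
    rcases v with v | v <;> simp only [PlaneTree.attach, PlaneTree.size_graft, iha, ihb] <;> omega

theorem size_parts (p : PlaneTree) (x : p.Edge) :
    p.size = (p.rootPart x).size + (p.branchPart x).size := by
  induction p with
  | leaf => exact x.elim
  | graft a b iha ihb =>
    rcases x with x | x | x <;>
      simp only [PlaneTree.rootPart, PlaneTree.branchPart, PlaneTree.size_graft]
    · have := iha x; omega
    · have := ihb x; omega

theorem size_of_beta_ne_zero {r t u : RTree} (h : RTree.beta r t u ≠ 0) :
    r.size = u.size + t.size := by
  classical
  obtain ⟨v, hv⟩ := Fintype.card_pos_iff.1 (Nat.pos_of_ne_zero h)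
  rw [hv, RTree.size_mk, size_attach, ← RTree.size_mk, ← RTree.size_mk, RTree.mk_rep, RTree.mk_rep]

theorem size_of_alpha_ne_zero {s u r : RTree} (h : RTree.alpha s u r ≠ 0) :
    u.size = r.size + s.size := by
  classical
  obtain ⟨x, hx, hx'⟩ := Fintype.card_pos_iff.1 (Nat.pos_of_ne_zero h)
  rw [← hx, ← hx', RTree.size_mk, RTree.size_mk, ← size_parts, ← RTree.size_mk, RTree.mk_rep]

/-- `r ↦ β(s, t, r)` as a finitely supported function. -/
noncomputable def betaF (s t : RTree) : Tr :=
  Finsupp.ofSupportFinite (fun r => (RTree.beta s t r : ℂ)) <| by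
    refine (RTree.finite_size_le s.size).subset fun r hr => ?_
    have h : RTree.beta s t r ≠ 0 := by simpa using hr
    have := size_of_beta_ne_zero h
    simp only [Set.mem_ofPred_eq]
    omega

/-- `r ↦ α(t, r, s)` as a finitely supported function. -/
noncomputable def alphaF (t s : RTree) : Tr :=
  Finsupp.ofSupportFinite (fun r => (RTree.alpha t r s : ℂ)) <| by
    refine (RTree.finite_size_le (s.size + t.size)).subset fun r hr => ?_
    have h : RTree.alpha t r s ≠ 0 := by simpa using hr
    have := size_of_alpha_ne_zero h
    simp only [Set.mem_ofPred_eq]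
    omega

theorem betaF_apply (s t r : RTree) : betaF s t r = (RTree.beta s t r : ℂ) := rfl

theorem alphaF_apply (t s r : RTree) : alphaF t s r = (RTree.alpha t r s : ℂ) := rfl

theorem map_eq_finsum {N : Type} [AddCommGroup N] [Module ℂ N] (F : Tr →ₗ[ℂ] N) (x : Tr) :
    F x = ∑ᶠ r, x r • F (e r) := by
  rw [finsum_eq_sum_of_support_subset (s := x.support)]
  · conv_lhs => rw [← Finsupp.sum_single x]
    rw [Finsupp.sum, map_sum]
    refine Finset.sum_congr rfl fun r _ => ?_
    rw [← map_smul]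
    simp [e]
  · intro r hr
    simp only [Finset.mem_coe, Finsupp.mem_support_iff]
    intro h
    simp [h] at hr

/-- The linear embedding `t ↦ D_t⁺`. -/
noncomputable def DpL : Tr →ₗ[ℂ] Alg := Finsupp.lsum ℂ fun t => LinearMap.toSpanSingleton ℂ _ (Dp t)

/-- The linear embedding `t ↦ D_t⁻`. -/
noncomputable def DmL : Tr →ₗ[ℂ] Alg := Finsupp.lsum ℂ fun t => LinearMap.toSpanSingleton ℂ _ (Dm t)

theorem DpL_e (t : RTree) : DpL (e t) = Dp t := by simp [DpL, e]

theorem DmL_e (t : RTree) : DmL (e t) = Dm t := by simp [DmL, e]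

theorem brBasis_plus_plus (s t : RTree) :
    brBasis (.plus s) (.plus t) = DpL (ins s t - ins t s) := by
  rw [map_eq_finsum]
  simp only [DpL_e, Finsupp.sub_apply, ins_apply, brBasis]

theorem brBasis_minus_minus (s t : RTree) :
    brBasis (.minus s) (.minus t) = DmL (alphaF t s - alphaF s t) := by
  rw [map_eq_finsum]
  simp only [DmL_e, Finsupp.sub_apply, alphaF_apply, brBasis]

theorem elim_self (t : RTree) : elim t t = 0 := by
  ext r
  rw [elim_apply]
  by_contra h
  have h' : RTree.alpha t t r ≠ 0 := by simpa using h
  have := size_of_alpha_ne_zero h'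
  have := r.size_pos
  omega

theorem betaF_self (t : RTree) : betaF t t = 0 := by
  ext r
  rw [betaF_apply]
  by_contra h
  have h' : RTree.beta t t r ≠ 0 := by simpa using h
  have := size_of_beta_ne_zero h'
  have := r.size_pos
  omega

open Classical in
theorem brMP_eq (s t : RTree) :
    brMP s t = DpL (elim s t) + DmL (betaF s t) + if t = s then dd else 0 := by
  unfold brMP
  by_cases h : s = t
  · subst h
    simp [elim_self, betaF_self]
  · rw [if_neg h, if_neg (Ne.symm h), add_zero, map_eq_finsum DpL, map_eq_finsum DmL]
    simp only [DpL_e, DmL_e, elim_apply, betaF_apply]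

/-- The operator of insertion. -/
noncomputable def opP (t : RTree) : Module.End ℂ Tr :=
  Finsupp.lsum ℂ fun u => LinearMap.toSpanSingleton ℂ _ (ins t u)

/-- The operator of elimination. -/
noncomputable def opM (s : RTree) : Module.End ℂ Tr :=
  Finsupp.lsum ℂ fun u => LinearMap.toSpanSingleton ℂ _ (elim s u)

/-- The operator counting vertices. -/
noncomputable def opD : Module.End ℂ Tr :=
  Finsupp.lsum ℂ fun u => LinearMap.toSpanSingleton ℂ _ ((u.size : ℂ) • e u)

theorem opP_e (t u : RTree) : opP t (e u) = ins t u := by simp [opP, e]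

theorem opM_e (t u : RTree) : opM t (e u) = elim t u := by simp [opM, e]

theorem opD_e (u : RTree) : opD (e u) = (u.size : ℂ) • e u := by simp [opD, e]

/-- The action of `𝔤` on trees. -/
noncomputable def act : Alg →ₗ[ℂ] Module.End ℂ Tr :=
  basis.constr ℂ fun i => match i with
    | .d => opD
    | .plus t => opP t
    | .minus t => opM t

theorem act_dd : act dd = opD := by simp [act, dd]

theorem act_Dp (t : RTree) : act (Dp t) = opP t := by simp [act, Dp]

theorem act_Dm (t : RTree) : act (Dm t) = opM t := by simp [act, Dm]

theorem bilin_ext {N : Type} [AddCommGroup N] [Module ℂ N] {F G : Tr →ₗ[ℂ] Tr →ₗ[ℂ] N}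
    (h : ∀ a b, F (e a) (e b) = G (e a) (e b)) : F = G := by
  refine Finsupp.lhom_ext' fun a => LinearMap.ext_ring ?_
  refine Finsupp.lhom_ext' fun b => LinearMap.ext_ring ?_
  exact h a b

/-- An operator is a derivation of `gr` up to the correction `gr x y ↦ c(y) x`. -/
def QDer (T : Module.End ℂ Tr) (c : Tr →ₗ[ℂ] ℂ) : Prop :=
  ∀ x y, T (gr x y) = gr (T x) y + gr x (T y) + c y • x

theorem qder_of (T : Module.End ℂ Tr) (c : Tr →ₗ[ℂ] ℂ)
    (h : ∀ a b, T (e (RTree.graft a b)) = gr (T (e a)) (e b) + gr (e a) (T (e b)) + c (e b) • e a) :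
    QDer T c := by
  intro x y
  have : gr.compr₂ T = gr.comp T + gr.compl₂ T + (LinearMap.lsmul ℂ Tr).flip.compl₂ c := by
    apply bilin_ext
    intro a b
    simp only [LinearMap.compr₂_apply, gr_single, h]
    simp
  simpa using congrArg (fun F => F x y) this

theorem qder_opP (t : RTree) : QDer (opP t) 0 := by
  refine qder_of _ _ fun a b => ?_
  simp only [opP_e, ins_graft, LinearMap.zero_apply, zero_smul, add_zero]

theorem qder_opD : QDer opD 0 := by
  refine qder_of _ _ fun a b => ?_
  simp only [opD_e, RTree.size_graft, LinearMap.zero_apply, zero_smul, add_zero, map_smul,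
    LinearMap.smul_apply, gr_single, Nat.cast_add, add_smul]

theorem qder_opM (s : RTree) : QDer (opM s) (Finsupp.lapply s) := by
  classical
  refine qder_of _ _ fun a b => ?_
  simp only [opM_e, elim_graft, Finsupp.lapply_apply, e, Finsupp.single_apply]
  split_ifs <;> simp

/-- The commutator of operators. -/
noncomputable def cm (S T : Module.End ℂ Tr) : Module.End ℂ Tr := S ∘ₗ T - T ∘ₗ S

theorem cm_apply (S T : Module.End ℂ Tr) (x : Tr) : cm S T x = S (T x) - T (S x) := rfl

theorem neg_cm (S T : Module.End ℂ Tr) : -cm S T = cm T S :=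
  LinearMap.ext fun _ => neg_sub (S _) (T _)

theorem cm_self (S : Module.End ℂ Tr) : cm S S = 0 :=
  LinearMap.ext fun _ => sub_self (S _)

theorem QDer.lie {S T : Module.End ℂ Tr} {c c' : Tr →ₗ[ℂ] ℂ} (hS : QDer S c) (hT : QDer T c') :
    QDer (cm S T) (c ∘ₗ T - c' ∘ₗ S) := by
  intro x y
  have h1 : (c ∘ₗ T - c' ∘ₗ S) y = c (T y) - c' (S y) := rfl
  have h2 : ∀ a b : Tr, gr (a - b) y = gr a y - gr b y := fun a b => by rw [map_sub]; rfl
  rw [h1, cm_apply, cm_apply, cm_apply, h2, map_sub, sub_smul]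
  simp only [hT x y, hS x y, map_add, hS _ y, hT _ y, hS x _, hT x _, map_smul]
  abel

theorem QDer.ext {S T : Module.End ℂ Tr} {c c' : Tr →ₗ[ℂ] ℂ} (hS : QDer S c) (hT : QDer T c')
    (h0 : S (e RTree.leaf) = T (e RTree.leaf)) (hc : ∀ b, c (e b) = c' (e b)) : S = T := by
  refine Finsupp.lhom_ext' fun u => LinearMap.ext_ring ?_
  change S (e u) = T (e u)
  induction u using RTree.ind with
  | h0 => exact h0
  | h a b iha ihb => rw [← gr_single, hS, hT, iha, ihb, hc]

theorem QDer.add {S T : Module.End ℂ Tr} {c c' : Tr →ₗ[ℂ] ℂ} (hS : QDer S c) (hT : QDer T c') :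
    QDer (S + T) (c + c') := by
  intro x y
  simp only [LinearMap.add_apply, hS x y, hT x y, map_add, add_smul]
  abel

theorem QDer.smul {S : Module.End ℂ Tr} {c : Tr →ₗ[ℂ] ℂ} (q : ℂ) (hS : QDer S c) :
    QDer (q • S) (q • c) := by
  intro x y
  simp only [LinearMap.smul_apply, hS x y, map_smul, smul_add, smul_eq_mul, mul_smul]

theorem qder_DpL (x : Tr) : QDer (act (DpL x)) 0 := by
  induction x using Finsupp.induction_linear with
  | zero => simp only [map_zero]; intro x y; simp
  | add f g hf hg => simpa using hf.add hg
  | single t q =>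
    have : (Finsupp.single t q : Tr) = q • e t := by simp [e]
    rw [this, map_smul, map_smul, DpL_e, act_Dp]
    simpa using (qder_opP t).smul q

/-- The functional with prescribed values `x r`. -/
noncomputable def pairing (x : Tr) : Tr →ₗ[ℂ] ℂ :=
  Finsupp.lsum ℂ fun b => LinearMap.toSpanSingleton ℂ _ (x b)

theorem pairing_e (x : Tr) (b : RTree) : pairing x (e b) = x b := by simp [pairing, e]

theorem qder_DmL (x : Tr) : QDer (act (DmL x)) (pairing x) := by
  classical
  induction x using Finsupp.induction_linear with
  | zero =>
    have : pairing 0 = 0 := by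
      refine Finsupp.lhom_ext' fun b => LinearMap.ext_ring ?_
      simpa using pairing_e 0 b
    rw [this]; simp only [map_zero]; intro x y; simp
  | add f g hf hg =>
    have : pairing (f + g) = pairing f + pairing g := by
      refine Finsupp.lhom_ext' fun b => LinearMap.ext_ring ?_
      change pairing (f + g) (e b) = pairing f (e b) + pairing g (e b)
      simp only [pairing_e, Finsupp.add_apply]
    rw [this]; simpa using hf.add hg
  | single t q =>
    have h1 : (Finsupp.single t q : Tr) = q • e t := by simp [e]
    have h2 : pairing (Finsupp.single t q) = q • Finsupp.lapply t := by
      refine Finsupp.lhom_ext' fun b => LinearMap.ext_ring ?_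
      change pairing (Finsupp.single t q) (e b) = q • (e b) t
      simp only [pairing_e, e, Finsupp.single_apply, smul_eq_mul]
      by_cases h : t = b
      · simp [h]
      · simp [h, Ne.symm h]
    rw [h2, h1, map_smul, map_smul, DmL_e, act_Dm]
    exact (qder_opM t).smul q

theorem act_DpL_leaf (x : Tr) : act (DpL x) (e RTree.leaf) = gr (e RTree.leaf) x := by
  have : (LinearMap.applyₗ (e RTree.leaf)) ∘ₗ act ∘ₗ DpL = gr (e RTree.leaf) := by
    refine Finsupp.lhom_ext' fun t => LinearMap.ext_ring ?_
    change act (DpL (e t)) (e RTree.leaf) = gr (e RTree.leaf) (e t)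
    rw [DpL_e, act_Dp, opP_e, ins_leaf]
  exact congrArg (fun F => F x) this

theorem act_DmL_leaf (x : Tr) : act (DmL x) (e RTree.leaf) = 0 := by
  have : (LinearMap.applyₗ (e RTree.leaf)) ∘ₗ act ∘ₗ DmL = 0 := by
    refine Finsupp.lhom_ext' fun t => LinearMap.ext_ring ?_
    change act (DmL (e t)) (e RTree.leaf) = 0
    rw [DmL_e, act_Dm, opM_e, elim_leaf]
  exact congrArg (fun F => F x) this

theorem opD_of_homogeneous (n : ℕ) (x : Tr) (h : ∀ r, x r ≠ 0 → r.size = n) :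
    opD x = (n : ℂ) • x := by
  conv_lhs => rw [← Finsupp.sum_single x]
  conv_rhs => rw [← Finsupp.sum_single x]
  rw [Finsupp.sum, map_sum, Finset.smul_sum]
  refine Finset.sum_congr rfl fun r hr => ?_
  have h1 : (Finsupp.single r (x r) : Tr) = x r • e r := by simp [e]
  rw [h1, map_smul, opD_e, h r (Finsupp.mem_support_iff.1 hr), smul_comm]

theorem opD_ins (t u : RTree) : opD (ins t u) = ((u.size + t.size : ℕ) : ℂ) • ins t u := by
  refine opD_of_homogeneous _ _ fun r hr => size_of_beta_ne_zero ?_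
  rw [ins_apply] at hr
  exact_mod_cast hr

theorem act_d_plus (t : RTree) : cm opD (opP t) = (t.size : ℂ) • opP t := by
  refine Finsupp.lhom_ext' fun u => LinearMap.ext_ring ?_
  change (cm opD (opP t)) (e u) = ((t.size : ℂ) • opP t) (e u)
  simp only [cm_apply, LinearMap.smul_apply,
    opD_e, opP_e, map_smul, opD_ins]
  rw [← sub_smul]; congr 1; push_cast; ring

theorem act_d_minus (t : RTree) : cm opD (opM t) = -((t.size : ℂ) • opM t) := by
  refine Finsupp.lhom_ext' fun u => LinearMap.ext_ring ?_
  change (cm opD (opM t)) (e u) = (-((t.size : ℂ) • opM t)) (e u)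
  simp only [cm_apply, LinearMap.smul_apply,
    LinearMap.neg_apply, opD_e, opM_e, map_smul]
  by_cases h : ∃ r, elim t u r ≠ 0
  · obtain ⟨r, hr⟩ := h
    rw [elim_apply] at hr
    have hs := size_of_alpha_ne_zero (Nat.cast_ne_zero.1 hr)
    rw [opD_of_homogeneous (u.size - t.size) (elim t u), ← sub_smul, ← neg_smul]
    · congr 1
      rw [Nat.cast_sub (by omega)]; ring
    · intro r' hr'
      rw [elim_apply] at hr'
      have := size_of_alpha_ne_zero (Nat.cast_ne_zero.1 hr')
      omega
  · have : elim t u = 0 := by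
      ext r; by_contra hr; exact h ⟨r, hr⟩
    simp [this]

theorem act_plus_plus (s t : RTree) :
    act (brBasis (.plus s) (.plus t)) = cm (opP s) (opP t) := by
  rw [brBasis_plus_plus]
  refine QDer.ext (qder_DpL _) ((qder_opP s).lie (qder_opP t)) ?_ (by simp)
  rw [act_DpL_leaf]
  simp only [cm_apply, opP_e, ins_leaf,
    qder_opP s _ _, qder_opP t _ _, LinearMap.zero_apply, zero_smul, add_zero, map_sub]
  rw [gr_swap (e RTree.leaf) (e s) (e t)]
  abel

theorem act_minus_minus (s t : RTree) :
    act (brBasis (.minus s) (.minus t)) = cm (opM s) (opM t) := by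
  rw [brBasis_minus_minus]
  refine QDer.ext (qder_DmL _) ((qder_opM s).lie (qder_opM t)) ?_ ?_
  · rw [act_DmL_leaf]
    simp [cm_apply, opM_e, elim_leaf]
  · intro b
    simp [pairing_e, opM_e, elim_apply, alphaF_apply]

theorem act_minus_plus (s t : RTree) : act (brMP s t) = cm (opM s) (opP t) := by
  classical
  have hd : QDer (act (if t = s then dd else 0)) 0 := by
    split_ifs
    · rw [act_dd]; exact qder_opD
    · rw [map_zero]; intro x y; simp
  rw [brMP_eq, map_add, map_add]
  refine QDer.ext (((qder_DpL _).add (qder_DmL _)).add hd) ((qder_opM s).lie (qder_opP t)) ?_ ?_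
  · simp only [LinearMap.add_apply, act_DpL_leaf, act_DmL_leaf, cm_apply, opP_e, opM_e, ins_leaf, elim_leaf, map_zero, qder_opM s (e RTree.leaf) (e t)]
    split_ifs with h
    · subst h
      simp [act_dd, opD_e, RTree.size_leaf, e]
    · simp [e, h]
  · intro b
    simp [pairing_e, opP_e, ins_apply, betaF_apply]

theorem act_brBasis (i j : Index) : act (brBasis i j) = cm (act (basis i)) (act (basis j)) := by
  have hd : act (basis .d) = opD := act_dd
  have hp : ∀ t, act (basis (.plus t)) = opP t := act_Dp
  have hm : ∀ t, act (basis (.minus t)) = opM t := act_Dm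
  rcases i with _ | s | s <;> rcases j with _ | t | t <;> simp only [hd, hp, hm]
  · simp [brBasis, cm_self]
  · rw [act_d_plus]; simp [brBasis, act_Dp]
  · rw [act_d_minus]; simp [brBasis, act_Dm]
  · rw [← neg_cm, act_d_plus]; simp [brBasis, act_Dp]
  · exact act_plus_plus s t
  · rw [← neg_cm, ← act_minus_plus]; simp [brBasis]
  · rw [← neg_cm, act_d_minus]
    refine LinearMap.ext fun u => ?_
    change act ((s.size : ℂ) • Dm s) u = - -((s.size : ℂ) • opM s u)
    rw [neg_neg, map_smul, act_Dm, LinearMap.smul_apply]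
  · exact act_minus_plus s t
  · exact act_minus_minus s t

theorem act_br (x y : Alg) : act (br x y) = cm (act x) (act y) := by
  refine LinearMap.ext fun u => ?_
  rw [cm_apply, ← basis.linearCombination_repr x, ← basis.linearCombination_repr y]
  induction basis.repr x using Finsupp.induction_linear with
  | zero => simp
  | add f g hf hg => simp only [map_add, LinearMap.add_apply, hf, hg]; abel
  | single i c =>
  induction basis.repr y using Finsupp.induction_linear with
  | zero => simp
  | add f g hf hg => simp only [map_add, LinearMap.add_apply, hf, hg]; abel
  | single j c' =>
    simp only [Finsupp.linearCombination_single, map_smul, LinearMap.smul_apply, br_basis,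
      act_brBasis, cm_apply, smul_sub]
    rw [smul_comm c c' (act (basis j) _)]

theorem act_injective : Function.Injective act := by
  classical
  refine (injective_iff_map_eq_zero act).2 fun x hx => ?_
  -- decompose `x`
  have hgl : ∀ a b : RTree, RTree.graft a b ≠ RTree.leaf := by
    intro a b h
    have h1 := congrArg RTree.size h
    rw [RTree.size_graft, RTree.size_leaf] at h1
    have := a.size_pos
    have := b.size_pos
    omega
  have hgr : ∀ y : Tr, gr (e RTree.leaf) y RTree.leaf = 0 := by
    intro y
    have : (Finsupp.lapply RTree.leaf : Tr →ₗ[ℂ] ℂ) ∘ₗ gr (e RTree.leaf) = 0 := by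
      refine Finsupp.lhom_ext' fun t => LinearMap.ext_ring ?_
      change gr (e RTree.leaf) (e t) RTree.leaf = 0
      rw [gr_single]; simp [e, hgl]
    exact congrArg (fun F => F y) this
  have helim : ∀ s t : RTree, elim s (RTree.graft RTree.leaf t) RTree.leaf =
      if t = s then 1 else 0 := by
    intro s t
    rw [elim_graft, elim_leaf]
    simp only [map_zero, LinearMap.zero_apply, zero_add, Finsupp.add_apply, hgr]
    split_ifs <;> simp [e]
  have hz : ∀ u, act x u = 0 := by intro u; rw [hx]; rfl
  -- coefficient of `D_s⁺`
  have hP : ∀ s, basis.repr x (.plus s) = 0 := by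
    intro s
    have h : (Finsupp.lapply RTree.leaf : Tr →ₗ[ℂ] ℂ) ∘ₗ opM s ∘ₗ
        LinearMap.applyₗ (e RTree.leaf) ∘ₗ act = basis.coord (.plus s) := by
      refine basis.ext fun i => ?_
      rcases i with _ | t | t
      · change (opM s (act dd (e RTree.leaf))) RTree.leaf = _
        rw [act_dd, opD_e, map_smul, opM_e, elim_leaf]; simp
      · change (opM s (act (Dp t) (e RTree.leaf))) RTree.leaf = _
        rw [act_Dp, opP_e, ins_leaf, gr_single, opM_e, helim]
        simp [Finsupp.single_apply]
      · change (opM s (act (Dm t) (e RTree.leaf))) RTree.leaf = _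
        rw [act_Dm, opM_e, elim_leaf, map_zero]; simp
    have h' := congrArg (fun F => F x) h
    simp only [LinearMap.comp_apply, LinearMap.applyₗ_apply_apply, hz, map_zero] at h'
    exact h'.symm
  have hD : basis.repr x .d = 0 := by
    have h : (Finsupp.lapply RTree.leaf : Tr →ₗ[ℂ] ℂ) ∘ₗ
        LinearMap.applyₗ (e RTree.leaf) ∘ₗ act = basis.coord .d := by
      refine basis.ext fun i => ?_
      rcases i with _ | t | t
      · change (act dd (e RTree.leaf)) RTree.leaf = _
        rw [act_dd, opD_e, RTree.size_leaf]; simp [e]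
      · change (act (Dp t) (e RTree.leaf)) RTree.leaf = _
        rw [act_Dp, opP_e, ins_leaf, hgr]; simp
      · change (act (Dm t) (e RTree.leaf)) RTree.leaf = _
        rw [act_Dm, opM_e, elim_leaf]; simp
    have h' := congrArg (fun F => F x) h
    simp only [LinearMap.comp_apply, LinearMap.applyₗ_apply_apply, hz, map_zero] at h'
    exact h'.symm
  have hM : ∀ s, basis.repr x (.minus s) = 0 := by
    intro s
    set u := RTree.graft RTree.leaf s with hu
    have h : (Finsupp.lapply RTree.leaf : Tr →ₗ[ℂ] ℂ) ∘ₗ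
        LinearMap.applyₗ (e u) ∘ₗ act = basis.coord (.minus s) := by
      refine basis.ext fun i => ?_
      rcases i with _ | t | t
      · change (act dd (e u)) RTree.leaf = _
        rw [act_dd, opD_e]; simp [e, hu, hgl]
      · change (act (Dp t) (e u)) RTree.leaf = _
        rw [act_Dp, opP_e]
        have : ins t u RTree.leaf = 0 := by
          rw [ins_apply]
          by_contra hne
          have h1 := size_of_beta_ne_zero (Nat.cast_ne_zero.1 hne)
          rw [RTree.size_leaf] at h1
          have := u.size_pos
          have := t.size_pos
          omega
        rw [this]; simp
      · change (act (Dm t) (e u)) RTree.leaf = _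
        rw [act_Dm, opM_e, hu, helim]
        simp [Finsupp.single_apply, eq_comm]
    have h' := congrArg (fun F => F x) h
    simp only [LinearMap.comp_apply, LinearMap.applyₗ_apply_apply, hz, map_zero] at h'
    exact h'.symm
  refine basis.repr.injective ?_
  rw [map_zero]
  ext i
  rcases i with _ | t | t
  · exact hD
  · exact hP t
  · exact hM t

/-- `𝔤` is a Lie ring. -/
noncomputable instance : LieRing Alg where
  add_lie x y z := by change br (x + y) z = br x z + br y z; simp
  lie_add x y z := by change br x (y + z) = br x y + br x z; simp
  lie_self x := by
    apply act_injective
    change act (br x x) = act 0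
    rw [act_br, cm_self, map_zero]
  leibniz_lie x y z := by
    apply act_injective
    change act (br x (br y z)) = act (br (br x y) z + br y (br x z))
    rw [map_add]
    simp only [act_br]
    refine LinearMap.ext fun u => ?_
    simp only [cm_apply, LinearMap.add_apply, map_sub]
    abel

/-- The insertion-elimination Lie algebra over `ℂ`. -/
noncomputable instance : LieAlgebra ℂ Alg where
  lie_smul c x y := by change br x (c • y) = c • br x y; simp

theorem lie_basis (i j : Index) : ⁅basis i, basis j⁆ = brBasis i j := br_basis i j

/-! ### Whittaker modules -/

/-- The subalgebra `𝔫⁺`, spanned by the `D_t⁺`. -/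
noncomputable def nPlus : LieSubalgebra ℂ Alg where
  toSubmodule := Submodule.span ℂ (Set.range Dp)
  lie_mem' := by
    intro x y hx hy
    change ⁅x, y⁆ ∈ Submodule.span ℂ (Set.range Dp)
    refine Submodule.span_induction₂ (p := fun x y _ _ => ⁅x, y⁆ ∈ Submodule.span ℂ (Set.range Dp))
      ?_ ?_ ?_ ?_ ?_ ?_ ?_ hx hy
    · rintro _ _ ⟨s, rfl⟩ ⟨t, rfl⟩
      change ⁅basis (.plus s), basis (.plus t)⁆ ∈ _
      rw [lie_basis]
      exact finsum_induction (· ∈ Submodule.span ℂ (Set.range Dp)) (Submodule.zero_mem _)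
        (fun _ _ => Submodule.add_mem _)
        fun r => Submodule.smul_mem _ _ (Submodule.subset_span ⟨r, rfl⟩)
    · intro y _; rw [zero_lie]; exact Submodule.zero_mem _
    · intro x _; rw [lie_zero]; exact Submodule.zero_mem _
    · intro x y z _ _ _ h1 h2; rw [add_lie]; exact Submodule.add_mem _ h1 h2
    · intro x y z _ _ _ h1 h2; rw [lie_add]; exact Submodule.add_mem _ h1 h2
    · intro c x y _ _ h; rw [smul_lie]; exact Submodule.smul_mem _ _ h
    · intro c x y _ _ h; rw [lie_smul]; exact Submodule.smul_mem _ _ h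

/-- `D_t⁺` as an element of `𝔫⁺`. -/
noncomputable def nPlusD (t : RTree) : nPlus := ⟨Dp t, Submodule.subset_span ⟨t, rfl⟩⟩

/-- `η : 𝔫⁺ → ℂ` is root-bounded if `η(D_t⁺) = 0` for all `t` of sufficiently large root degree. -/
def RootBounded (η : nPlus →ₗ⁅ℂ⁆ ℂ) : Prop :=
  ∃ M : ℕ, 0 < M ∧ ∀ t : RTree, M ≤ t.rdeg → η (nPlusD t) = 0

/-- The universal enveloping algebra `U(𝔤)`. -/
abbrev Ug : Type := UniversalEnvelopingAlgebra ℂ Alg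

/-- The universal enveloping algebra `U(𝔫⁺)`. -/
abbrev Un : Type := UniversalEnvelopingAlgebra ℂ nPlus

/-- The algebra homomorphism `U(𝔫⁺) → U(𝔤)` induced by the inclusion `𝔫⁺ ⊆ 𝔤`. -/
noncomputable def UnToUg : Un →ₐ[ℂ] Ug :=
  UniversalEnvelopingAlgebra.lift ℂ ((UniversalEnvelopingAlgebra.ι ℂ).comp nPlus.incl)

/-- The action of `U(𝔫⁺)` on the one-dimensional module `ℂ_η`: `a ∈ U(𝔫⁺)` acts on `ℂ` as
multiplication by the scalar `etaU η a`. -/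
noncomputable def etaU (η : nPlus →ₗ⁅ℂ⁆ ℂ) : Un →ₐ[ℂ] ℂ := UniversalEnvelopingAlgebra.lift ℂ η

open scoped TensorProduct in
/-- The relations `ua ⊗ z = u ⊗ a z` (`u ∈ U(𝔤)`, `a ∈ U(𝔫⁺)`, `z ∈ ℂ_η`) that turn
`U(𝔤) ⊗_ℂ ℂ_η` into `U(𝔤) ⊗_{U(𝔫⁺)} ℂ_η`. -/
noncomputable def balanced (η : nPlus →ₗ⁅ℂ⁆ ℂ) : Submodule Ug (Ug ⊗[ℂ] ℂ) :=
  Submodule.span Ug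
    {w | ∃ (u : Ug) (a : Un) (z : ℂ), w = (u * UnToUg a) ⊗ₜ[ℂ] z - u ⊗ₜ[ℂ] (etaU η a * z)}

open scoped TensorProduct in
/-- The standard Whittaker module `M_η = U(𝔤) ⊗_{U(𝔫⁺)} ℂ_η`. -/
abbrev Whittaker (η : nPlus →ₗ⁅ℂ⁆ ℂ) : Type := (Ug ⊗[ℂ] ℂ) ⧸ balanced η

/-- The space of Whittaker vectors of type `η` in `M_η`: all `v` with `x v = η(x) v` for
`x ∈ 𝔫⁺`. -/
noncomputable def whittakerVectors (η : nPlus →ₗ⁅ℂ⁆ ℂ) : Submodule ℂ (Whittaker η) where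
  carrier := {v | ∀ x : nPlus, UniversalEnvelopingAlgebra.ι ℂ (x : Alg) • v = η x • v}
  zero_mem' := by intro x; simp
  add_mem' := by
    intro v w hv hw x
    rw [smul_add, smul_add, hv x, hw x]
  smul_mem' := by
    intro c v hv x
    rw [smul_comm, hv x, smul_comm]

end InsElim

namespace InsElim

/-- The multiset of root branches of a plane tree. -/
noncomputable def PlaneTree.branches : PlaneTree → Multiset RTree
  | leaf => 0
  | graft a b => RTree.mk b ::ₘ branches a

theorem PlaneTree.branches_eq_of_iso {a b : PlaneTree} (h : Iso a b) :
    a.branches = b.branches := by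
  induction h with
  | refl => rfl
  | symm _ ih => exact ih.symm
  | trans _ _ ih₁ ih₂ => exact ih₁.trans ih₂
  | graft _ h₂ ih₁ _ => simp only [branches, ih₁, RTree.mk_eq h₂]
  | swap a b c => exact Multiset.cons_swap _ _ _

namespace RTree

/-- The multiset of root branches of a tree. -/
noncomputable def branches (t : RTree) : Multiset RTree :=
  Quotient.lift PlaneTree.branches (fun _ _ => PlaneTree.branches_eq_of_iso) t

theorem branches_leaf : branches leaf = 0 := rfl

theorem branches_graft (a b : RTree) : (graft a b).branches = b ::ₘ a.branches := by
  induction a using Quotient.inductionOn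
  induction b using Quotient.inductionOn
  rfl

theorem rdeg_leaf : rdeg leaf = 0 := rfl

theorem rdeg_graft (a b : RTree) : (graft a b).rdeg = a.rdeg + 1 := by
  induction a using Quotient.inductionOn
  induction b using Quotient.inductionOn
  rfl

instance : RightCommutative graft := ⟨graft_swap⟩

/-- The tree with a given multiset of root branches. -/
def join (C : Multiset RTree) : RTree := C.foldl graft leaf

theorem join_zero : join 0 = leaf := rfl

theorem join_cons (b : RTree) (C : Multiset RTree) : join (b ::ₘ C) = graft (join C) b := by
  induction C using Multiset.induction with
  | empty => rfl
  | cons c C ih =>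
    have h : ∀ (C : Multiset RTree) (a b : RTree),
        C.foldl graft (graft a b) = graft (C.foldl graft a) b := by
      intro C
      induction C using Multiset.induction with
      | empty => intro a b; rfl
      | cons c C ih => intro a b; rw [Multiset.foldl_cons, graft_swap, ih, Multiset.foldl_cons]
    rw [join, Multiset.foldl_cons, h]
    rfl

theorem join_branches (t : RTree) : join t.branches = t := by
  induction t using ind with
  | h0 => rfl
  | h a b iha _ => rw [branches_graft, join_cons, iha]

theorem branches_join (C : Multiset RTree) : (join C).branches = C := by
  induction C using Multiset.induction with
  | empty => rfl
  | cons c C ih => rw [join_cons, branches_graft, ih]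

theorem card_branches (t : RTree) : Multiset.card t.branches = t.rdeg := by
  induction t using ind with
  | h0 => rfl
  | h a b iha _ => rw [branches_graft, Multiset.card_cons, iha, rdeg_graft]

theorem rdeg_join (C : Multiset RTree) : (join C).rdeg = Multiset.card C := by
  rw [← card_branches, branches_join]

theorem size_join (C : Multiset RTree) : (join C).size = (C.map size).sum + 1 := by
  induction C using Multiset.induction with
  | empty => rfl
  | cons c C ih => rw [join_cons, size_graft, ih, Multiset.map_cons, Multiset.sum_cons]; omega

theorem graft_eq_graft {a b a' b' : RTree} (h : graft a b = graft a' b') :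
    (a = a' ∧ b = b') ∨ ∃ c, a = graft c b' ∧ a' = graft c b := by
  have h1 := congrArg branches h
  rw [branches_graft, branches_graft, Multiset.cons_eq_cons] at h1
  rcases h1 with ⟨hb, ha⟩ | ⟨_, C, h1, h2⟩
  · exact Or.inl ⟨by rw [← join_branches a, ha, join_branches], hb⟩
  · refine Or.inr ⟨join C, ?_, ?_⟩
    · rw [← join_branches a, h1, join_cons]
    · rw [← join_branches a', h2, join_cons]

theorem exists_graft_of_ne_leaf {t : RTree} (h : t ≠ leaf) : ∃ a b, t = graft a b := by
  induction t using ind with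
  | h0 => exact absurd rfl h
  | h a b _ _ => exact ⟨a, b, rfl⟩

theorem graft_ne_leaf (a b : RTree) : graft a b ≠ leaf := fun h => by
  simpa [rdeg_graft, rdeg_leaf] using congrArg rdeg h

end RTree

theorem Tr.hom_ext {N : Type*} [AddCommMonoid N] [Module ℂ N] {F G : Tr →ₗ[ℂ] N}
    (h : ∀ t, F (e t) = G (e t)) : F = G :=
  Finsupp.lhom_ext' fun t => LinearMap.ext_ring (h t)

/-- Linear combinations of trees with a given property. -/
noncomputable abbrev treesWith (P : RTree → Prop) : Submodule ℂ Tr := Finsupp.supported ℂ ℂ {t | P t}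

theorem e_mem_treesWith {P : RTree → Prop} {t : RTree} (h : P t) : e t ∈ treesWith P :=
  Finsupp.single_mem_supported _ _ h

theorem treesWith_mono {P Q : RTree → Prop} (h : ∀ t, P t → Q t) : treesWith P ≤ treesWith Q :=
  Finsupp.supported_mono h

theorem treesWith_induction {P : RTree → Prop} {p : Tr → Prop} (h0 : p 0)
    (ha : ∀ x y, p x → p y → p (x + y)) (hs : ∀ (c : ℂ) x, p x → p (c • x))
    (he : ∀ t, P t → p (e t)) {x : Tr} (hx : x ∈ treesWith P) : p x := by
  rw [treesWith, Finsupp.supported_eq_span_single] at hx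
  induction hx using Submodule.span_induction with
  | mem x h => obtain ⟨t, ht, rfl⟩ := h; exact he t ht
  | zero => exact h0
  | add x y _ _ hx hy => exact ha x y hx hy
  | smul c x _ hx => exact hs c x hx

theorem map_mem_of_treesWith {N : Type*} [AddCommGroup N] [Module ℂ N] {P : RTree → Prop}
    {F : Tr →ₗ[ℂ] N} {V : Submodule ℂ N} (he : ∀ t, P t → F (e t) ∈ V) {x : Tr}
    (hx : x ∈ treesWith P) : F x ∈ V := by
  refine treesWith_induction (p := fun x => F x ∈ V) ?_ ?_ ?_ he hx
  · rw [map_zero]; exact V.zero_mem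
  · intro x y hx hy; rw [map_add]; exact V.add_mem hx hy
  · intro c x hx; rw [map_smul]; exact V.smul_mem c hx

theorem mem_treesWith_true (x : Tr) : x ∈ treesWith fun _ => True := by
  simp [treesWith]

theorem gr_mem_rdeg {n : ℕ} {x : Tr} (hx : x ∈ treesWith fun t => t.rdeg = n) (y : Tr) :
    gr x y ∈ treesWith fun t => t.rdeg = n + 1 := by
  refine map_mem_of_treesWith (F := gr.flip y) (fun a ha => ?_) hx
  refine map_mem_of_treesWith (F := gr (e a)) (fun b _ => ?_) (mem_treesWith_true y)
  rw [gr_single]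
  exact e_mem_treesWith (by rw [RTree.rdeg_graft, ha])

/-- Insertion at the vertices other than the root. -/
noncomputable def innerP (t : RTree) : Module.End ℂ Tr := opP t - gr.flip (e t)

theorem innerP_apply (t : RTree) (x : Tr) : innerP t x = opP t x - gr x (e t) := rfl

theorem innerP_leaf (t : RTree) : innerP t (e RTree.leaf) = 0 := by
  rw [innerP_apply, opP_e, ins_leaf, sub_self]

theorem innerP_gr (t : RTree) (x y : Tr) :
    innerP t (gr x y) = gr (innerP t x) y + gr x (opP t y) := by
  simp only [innerP_apply, qder_opP t x y, map_sub, LinearMap.sub_apply, LinearMap.zero_apply,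
    zero_smul, add_zero]
  rw [gr_swap x y]
  abel

theorem innerP_mem_rdeg (b : RTree) {n : ℕ} {x : Tr} (hx : x ∈ treesWith fun t => t.rdeg = n) :
    innerP b x ∈ treesWith fun t => t.rdeg = n := by
  refine map_mem_of_treesWith (fun t ht => ?_) hx
  clear hx
  subst ht
  induction t using RTree.ind with
  | h0 => rw [innerP_leaf]; exact Submodule.zero_mem _
  | h a c iha _ =>
    rw [← gr_single, innerP_gr, RTree.rdeg_graft]
    exact Submodule.add_mem _ (gr_mem_rdeg iha _) (gr_mem_rdeg (e_mem_treesWith rfl) _)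

open Classical in
/-- Elimination of a branch `s` at the root. -/
noncomputable def rootM (s : RTree) : Module.End ℂ Tr :=
  Finsupp.lsum ℂ fun t => LinearMap.toSpanSingleton ℂ _
    ((t.branches.count s : ℂ) • e (RTree.join (t.branches.erase s)))

open Classical in
theorem rootM_e (s t : RTree) : rootM s (e t) =
    (t.branches.count s : ℂ) • e (RTree.join (t.branches.erase s)) := by
  simp [rootM, e]

theorem rootM_leaf (s : RTree) : rootM s (e RTree.leaf) = 0 := by
  simp [rootM_e, RTree.branches_leaf]

open Classical in
theorem rootM_graft (s a b : RTree) : rootM s (e (RTree.graft a b)) =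
    gr (rootM s (e a)) (e b) + if b = s then e a else 0 := by
  rw [rootM_e, rootM_e, RTree.branches_graft, map_smul, LinearMap.smul_apply, gr_single]
  by_cases h : b = s
  · subst h
    rw [Multiset.count_cons_self, Multiset.erase_cons_head, if_pos rfl, RTree.join_branches]
    by_cases hb : b ∈ a.branches
    · rw [← RTree.join_cons, Multiset.cons_erase hb, RTree.join_branches]
      push_cast
      rw [add_smul, one_smul]
    · simp [Multiset.count_eq_zero_of_notMem hb]
  · rw [if_neg h, add_zero, Multiset.erase_cons_tail _ (by simpa using h), RTree.join_cons,
      Multiset.count_cons_of_ne (Ne.symm h)]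

theorem rootM_gr (s : RTree) (x y : Tr) : rootM s (gr x y) = gr (rootM s x) y + y s • x := by
  classical
  have : gr.compr₂ (rootM s) = gr.comp (rootM s) +
      (LinearMap.lsmul ℂ Tr).flip.compl₂ (Finsupp.lapply s) := by
    apply bilin_ext
    intro a b
    simp only [LinearMap.compr₂_apply, gr_single, rootM_graft]
    by_cases h : b = s <;> simp [h, e]
  simpa using congrArg (fun F => F x y) this

theorem rootM_mem_rdeg (s : RTree) {n : ℕ} {x : Tr} (hx : x ∈ treesWith fun t => t.rdeg = n + 1) :
    rootM s x ∈ treesWith fun t => t.rdeg = n := by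
  classical
  refine map_mem_of_treesWith (fun t ht => ?_) hx
  rw [rootM_e]
  by_cases h : s ∈ t.branches
  · refine Submodule.smul_mem _ _ (e_mem_treesWith ?_)
    rw [RTree.rdeg_join, Multiset.card_erase_of_mem h, RTree.card_branches, ht]
    rfl
  · simp [Multiset.count_eq_zero_of_notMem h]

/-- Elimination of a branch at an edge that does not contain the root. -/
noncomputable def innerM (s : RTree) : Module.End ℂ Tr := opM s - rootM s

theorem innerM_apply (s : RTree) (x : Tr) : innerM s x = opM s x - rootM s x := rfl

theorem innerM_leaf (s : RTree) : innerM s (e RTree.leaf) = 0 := by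
  rw [innerM_apply, opM_e, elim_leaf, rootM_leaf, sub_self]

theorem innerM_gr (s : RTree) (x y : Tr) :
    innerM s (gr x y) = gr (innerM s x) y + gr x (opM s y) := by
  simp only [innerM_apply, qder_opM s x y, rootM_gr, map_sub, LinearMap.sub_apply,
    Finsupp.lapply_apply]
  abel

theorem innerM_mem_rdeg (b : RTree) {n : ℕ} {x : Tr} (hx : x ∈ treesWith fun t => t.rdeg = n) :
    innerM b x ∈ treesWith fun t => t.rdeg = n := by
  refine map_mem_of_treesWith (fun t ht => ?_) hx
  clear hx
  subst ht
  induction t using RTree.ind with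
  | h0 => rw [innerM_leaf]; exact Submodule.zero_mem _
  | h a c iha _ =>
    rw [← gr_single, innerM_gr, RTree.rdeg_graft]
    exact Submodule.add_mem _ (gr_mem_rdeg iha _) (gr_mem_rdeg (e_mem_treesWith rfl) _)

theorem opM_mem_size (s : RTree) {n : ℕ} {x : Tr}
    (hx : x ∈ treesWith fun t => t.size = s.size + n) : opM s x ∈ treesWith fun t => t.size = n := by
  refine map_mem_of_treesWith (fun t ht => ?_) hx
  rw [opM_e, treesWith, Finsupp.mem_supported]
  intro r hr
  have hr' : elim s t r ≠ 0 := Finsupp.mem_support_iff.1 hr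
  rw [elim_apply, Nat.cast_ne_zero] at hr'
  have := size_of_alpha_ne_zero hr'
  change r.size = n
  omega

end InsElim

namespace InsElim

theorem Alg.induction {p : Alg → Prop} (h0 : p 0) (ha : ∀ x y, p x → p y → p (x + y))
    (hs : ∀ (c : ℂ) x, p x → p (c • x)) (hb : ∀ i, p (basis i)) (x : Alg) : p x := by
  have hx := basis.mem_span x
  induction hx using Submodule.span_induction with
  | mem x h => obtain ⟨i, rfl⟩ := h; exact hb i
  | zero => exact h0
  | add x y _ _ hx hy => exact ha x y hx hy
  | smul c x _ hx => exact hs c x hx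

theorem Alg.hom_ext {N : Type*} [AddCommMonoid N] [Module ℂ N] {F G : Alg →ₗ[ℂ] N}
    (hd : F dd = G dd) (hp : ∀ t, F (Dp t) = G (Dp t)) (hm : ∀ t, F (Dm t) = G (Dm t)) : F = G := by
  refine basis.ext fun i => ?_
  rcases i with _ | t | t
  · exact hd
  · exact hp t
  · exact hm t

/-- The functional measuring the failure of `act x` to be a derivation of `gr`. -/
noncomputable def defect : Alg →ₗ[ℂ] (Tr →ₗ[ℂ] ℂ) :=
  basis.constr ℂ fun i => match i with
    | .d => 0
    | .plus _ => 0
    | .minus t => Finsupp.lapply t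

theorem defect_dd : defect dd = 0 := by simp [defect, dd]

theorem defect_Dp (t : RTree) : defect (Dp t) = 0 := by simp [defect, Dp]

theorem defect_Dm (t : RTree) : defect (Dm t) = Finsupp.lapply t := by simp [defect, Dm]

/-- The infinitesimal deformation of the action on trees that changes the lowest weight. -/
noncomputable def defAct : Alg →ₗ[ℂ] Module.End ℂ Tr :=
  basis.constr ℂ fun i => match i with
    | .d => 1
    | .plus _ => 0
    | .minus t => rootM t

theorem defAct_dd : defAct dd = 1 := by simp [defAct, dd]

theorem defAct_Dp (t : RTree) : defAct (Dp t) = 0 := by simp [defAct, Dp]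

theorem defAct_Dm (t : RTree) : defAct (Dm t) = rootM t := by simp [defAct, Dm]

/-- `T` acts on the left factor of `gr`, and `T'` on the right factor, up to a correction. -/
def SplitDer (T T' : Module.End ℂ Tr) (c : Tr →ₗ[ℂ] ℂ) : Prop :=
  ∀ x y, T (gr x y) = gr (T x) y + gr x (T' y) + c y • x

theorem SplitDer.add {S T S' T' : Module.End ℂ Tr} {c c' : Tr →ₗ[ℂ] ℂ} (hS : SplitDer S S' c)
    (hT : SplitDer T T' c') : SplitDer (S + T) (S' + T') (c + c') := by
  intro x y
  simp only [LinearMap.add_apply, hS x y, hT x y, map_add, add_smul]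
  abel

theorem SplitDer.smul {S S' : Module.End ℂ Tr} {c : Tr →ₗ[ℂ] ℂ} (q : ℂ) (hS : SplitDer S S' c) :
    SplitDer (q • S) (q • S') (q • c) := by
  intro x y
  simp only [LinearMap.smul_apply, hS x y, map_smul, smul_add, smul_eq_mul, mul_smul]

theorem SplitDer.lie {S T S' T' : Module.End ℂ Tr} {c c' : Tr →ₗ[ℂ] ℂ} (hS : SplitDer S S' c)
    (hT : SplitDer T T' c') : SplitDer (cm S T) (cm S' T') (c ∘ₗ T' - c' ∘ₗ S') := by
  intro x y
  have h1 : (c ∘ₗ T' - c' ∘ₗ S') y = c (T' y) - c' (S' y) := rfl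
  have h2 : ∀ a b : Tr, gr (a - b) y = gr a y - gr b y := fun a b => by rw [map_sub]; rfl
  rw [h1, cm_apply, cm_apply, cm_apply, h2, map_sub, sub_smul]
  simp only [hT x y, hS x y, map_add, hS _ y, hT _ y, hS x _, hT x _, map_smul]
  abel

theorem SplitDer.ext {S T T' : Module.End ℂ Tr} {c : Tr →ₗ[ℂ] ℂ} (hS : SplitDer S T' c)
    (hT : SplitDer T T' c) (h0 : S (e RTree.leaf) = T (e RTree.leaf)) : S = T := by
  refine Tr.hom_ext fun u => ?_
  induction u using RTree.ind with
  | h0 => exact h0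
  | h a b iha _ => rw [← gr_single, hS, hT, iha]

theorem splitDer_act (x : Alg) : SplitDer (act x) (act x) (defect x) := by
  induction x using Alg.induction with
  | h0 => intro x y; simp
  | ha x y hx hy => simpa using hx.add hy
  | hs c x hx => simpa using hx.smul c
  | hb i =>
    rcases i with _ | t | t
    · change SplitDer (act dd) (act dd) (defect dd)
      rw [act_dd, defect_dd]; exact qder_opD
    · change SplitDer (act (Dp t)) (act (Dp t)) (defect (Dp t))
      rw [act_Dp, defect_Dp]; exact qder_opP t
    · change SplitDer (act (Dm t)) (act (Dm t)) (defect (Dm t))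
      rw [act_Dm, defect_Dm]; exact qder_opM t

theorem splitDer_defAct (x : Alg) : SplitDer (defAct x) 0 (defect x) := by
  induction x using Alg.induction with
  | h0 => intro x y; simp
  | ha x y hx hy => simpa using hx.add hy
  | hs c x hx => simpa using hx.smul c
  | hb i =>
    intro x y
    rcases i with _ | t | t
    · change defAct dd _ = gr (defAct dd x) y + _ + defect dd y • x
      simp [defAct_dd, defect_dd]
    · change defAct (Dp t) _ = gr (defAct (Dp t) x) y + _ + defect (Dp t) y • x
      simp [defAct_Dp, defect_Dp]
    · change defAct (Dm t) _ = gr (defAct (Dm t) x) y + _ + defect (Dm t) y • x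
      simp [defAct_Dm, defect_Dm, rootM_gr]

theorem gr_apply_leaf (x y : Tr) : gr x y RTree.leaf = 0 := by
  have : gr.compr₂ (Finsupp.lapply RTree.leaf) = (0 : Tr →ₗ[ℂ] Tr →ₗ[ℂ] ℂ) := by
    apply bilin_ext
    intro a b
    simp [gr_single, e, RTree.graft_ne_leaf]
  simpa using congrArg (fun F => F x y) this

theorem e_leaf_apply_leaf : (e RTree.leaf : Tr) RTree.leaf = 1 := by simp [e]

/-- The projection of `𝔤` onto the span of the `D_t⁺`. -/
noncomputable def plusPart : Alg →ₗ[ℂ] Tr :=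
  basis.constr ℂ fun i => match i with
    | .d => 0
    | .plus t => e t
    | .minus _ => 0

theorem act_leaf (x : Alg) : act x (e RTree.leaf) =
    gr (e RTree.leaf) (plusPart x) + basis.coord .d x • e RTree.leaf := by
  induction x using Alg.induction with
  | h0 => simp
  | ha x y hx hy => simp only [map_add, LinearMap.add_apply, hx, hy, add_smul]; abel
  | hs c x hx => simp only [map_smul, LinearMap.smul_apply, hx, smul_add, smul_assoc]
  | hb i =>
    rcases i with _ | t | t
    · change act dd _ = _
      rw [act_dd, opD_e]
      simp [plusPart, RTree.size_leaf]
    · change act (Dp t) _ = _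
      rw [act_Dp, opP_e, ins_leaf]
      simp [plusPart]
    · change act (Dm t) _ = _
      rw [act_Dm, opM_e, elim_leaf]
      simp [plusPart]

theorem defAct_leaf (x : Alg) : defAct x (e RTree.leaf) = basis.coord .d x • e RTree.leaf := by
  induction x using Alg.induction with
  | h0 => simp
  | ha x y hx hy => simp only [map_add, LinearMap.add_apply, hx, hy, add_smul]
  | hs c x hx => simp only [map_smul, LinearMap.smul_apply, hx, smul_assoc]
  | hb i =>
    rcases i with _ | t | t
    · change defAct dd _ = _
      rw [defAct_dd]
      simp
    · change defAct (Dp t) _ = _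
      rw [defAct_Dp]
      simp
    · change defAct (Dm t) _ = _
      rw [defAct_Dm, rootM_leaf]
      simp

theorem defect_br (x y : Alg) : defect (br x y) = defect x ∘ₗ act y - defect y ∘ₗ act x := by
  ext1 u
  have h1 := splitDer_act (br x y) (e RTree.leaf)
  have h2 := (splitDer_act x).lie (splitDer_act y) (e RTree.leaf)
  rw [← act_br] at h2
  refine LinearMap.ext_ring ?_
  have h3 := congrArg (fun z : Tr => z RTree.leaf) ((h1 (e u)).symm.trans (h2 (e u)))
  simpa [gr_apply_leaf, e_leaf_apply_leaf] using h3

theorem coord_br (x y : Alg) : basis.coord .d (br x y) =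
    defect x (plusPart y) - defect y (plusPart x) := by
  have h : ∀ x y : Alg, act x (act y (e RTree.leaf)) RTree.leaf = defect x (plusPart y) +
      basis.coord .d y * basis.coord .d x := by
    intro x y
    rw [act_leaf y, map_add, splitDer_act x, map_smul, act_leaf x]
    simp [gr_apply_leaf, -Module.Basis.coord_apply]
  have h1 := congrArg (fun z : Tr => z RTree.leaf) (act_leaf (br x y))
  rw [act_br, cm_apply] at h1
  simp only [Finsupp.sub_apply, h, Finsupp.add_apply, gr_apply_leaf, zero_add, Finsupp.smul_apply,
    e_leaf_apply_leaf, smul_eq_mul, mul_one] at h1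
  rw [← h1]
  ring

theorem defAct_br (x y : Alg) :
    defAct (br x y) = cm (defAct x) (act y) + cm (act x) (defAct y) := by
  have h := ((splitDer_defAct x).lie (splitDer_act y)).add ((splitDer_act x).lie (splitDer_defAct y))
  have h0 : cm 0 (act y) + cm (act x) 0 = 0 := LinearMap.ext fun u => by simp [cm_apply]
  have h1 : defect x ∘ₗ act y - defect y ∘ₗ 0 + (defect x ∘ₗ 0 - defect y ∘ₗ act x) =
      defect (br x y) := by
    rw [defect_br]; simp [sub_eq_add_neg]
  rw [h0, h1] at h
  refine SplitDer.ext (splitDer_defAct _) h ?_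
  rw [defAct_leaf, coord_br]
  simp only [LinearMap.add_apply, cm_apply, defAct_leaf, act_leaf, map_add, map_smul,
    splitDer_defAct x _ _, splitDer_defAct y _ _, LinearMap.zero_apply, add_zero,
    LinearMap.smul_apply, map_zero]
  module

theorem defAct_comm (x y : Alg) : cm (defAct x) (defAct y) = 0 := by
  have h := (splitDer_defAct x).lie (splitDer_defAct y)
  refine SplitDer.ext (T' := 0) (c := 0) ?_ (fun x y => by simp) ?_
  · have h0 : cm (0 : Module.End ℂ Tr) 0 = 0 := cm_self 0
    rw [h0, LinearMap.comp_zero, LinearMap.comp_zero, sub_zero] at h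
    exact h
  · rw [cm_apply, defAct_leaf, defAct_leaf, map_smul, map_smul, defAct_leaf, defAct_leaf, smul_comm]
    simp

end InsElim

namespace InsElim

/-- `innerP`, extended linearly to linear combinations of trees. -/
noncomputable def innerL : Tr →ₗ[ℂ] Module.End ℂ Tr :=
  LinearMap.mk₂ ℂ (fun y x => act (DpL y) x - gr x y)
    (fun y y' x => by simp only [map_add, LinearMap.add_apply]; abel)
    (fun c y x => by simp only [map_smul, LinearMap.smul_apply, smul_sub])
    (fun y x x' => by simp only [map_add, LinearMap.add_apply]; abel)
    (fun c y x => by simp only [map_smul, LinearMap.smul_apply, smul_sub])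

theorem innerL_apply (y x : Tr) : innerL y x = act (DpL y) x - gr x y := rfl

theorem innerL_e (b : RTree) : innerL (e b) = innerP b := by
  ext1 u
  refine LinearMap.ext_ring ?_
  change innerL (e b) (e u) = innerP b (e u)
  rw [innerL_apply, DpL_e, act_Dp, innerP_apply]

theorem splitDer_innerL (y : Tr) : SplitDer (innerL y) (act (DpL y)) 0 := by
  intro u w
  simp only [innerL_apply, qder_DpL y u w, map_sub, LinearMap.sub_apply, LinearMap.zero_apply,
    zero_smul, add_zero]
  rw [gr_swap u w]
  abel

theorem innerL_leaf (y : Tr) : innerL y (e RTree.leaf) = 0 := by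
  rw [innerL_apply, act_DpL_leaf, sub_self]

theorem innerL_sub_ins (b c : RTree) (x : Tr) : innerL (ins b c) x - innerL (ins c b) x =
    innerP b (innerP c x) - innerP c (innerP b x) := by
  have h : innerL (ins b c - ins c b) = cm (innerP b) (innerP c) := by
    refine (splitDer_innerL _).ext (T' := act (DpL (ins b c - ins c b))) (c := 0) ?_ ?_
    · have h := (splitDer_innerL (e b)).lie (splitDer_innerL (e c))
      rw [innerL_e, innerL_e, DpL_e, DpL_e, act_Dp, act_Dp, ← act_plus_plus,
        brBasis_plus_plus] at h
      simpa using h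
    · rw [innerL_leaf, cm_apply, innerP_leaf, innerP_leaf, map_zero, map_zero, sub_zero]
  rw [← cm_apply, ← h, map_sub]
  rfl

open Classical in
/-- The Whittaker functional on trees of root degree `n`. -/
noncomputable def whitAux (θ : Tr →ₗ[ℂ] ℂ) : ℕ → (Tr →ₗ[ℂ] ℂ)
  | 0 => Finsupp.lapply RTree.leaf
  | n + 1 => Finsupp.lsum ℂ fun t => LinearMap.toSpanSingleton ℂ _ <|
      if h : t = RTree.leaf then 0 else
        θ (e (RTree.exists_graft_of_ne_leaf h).choose_spec.choose) *
          whitAux θ n (e (RTree.exists_graft_of_ne_leaf h).choose) -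
        whitAux θ n (innerP (RTree.exists_graft_of_ne_leaf h).choose_spec.choose
          (e (RTree.exists_graft_of_ne_leaf h).choose))

theorem exists_whitAux_graft (θ : Tr →ₗ[ℂ] ℂ) (n : ℕ) (a b : RTree) :
    ∃ a' b', RTree.graft a b = RTree.graft a' b' ∧ whitAux θ (n + 1) (e (RTree.graft a b)) =
      θ (e b') * whitAux θ n (e a') - whitAux θ n (innerP b' (e a')) := by
  refine ⟨_, _,
    (RTree.exists_graft_of_ne_leaf (RTree.graft_ne_leaf a b)).choose_spec.choose_spec, ?_⟩
  simp [whitAux, e, RTree.graft_ne_leaf]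

theorem whitAux_gr {θ : Tr →ₗ[ℂ] ℂ} (hθ : ∀ s t, θ (ins s t) = θ (ins t s)) (n : ℕ) {x : Tr}
    (hx : x ∈ treesWith fun t => t.rdeg = n) (y : Tr) :
    whitAux θ (n + 1) (gr x y) = θ y * whitAux θ n x - whitAux θ n (innerL y x) := by
  induction n generalizing x y with
  | zero =>
    refine treesWith_induction (p := fun x => whitAux θ 1 (gr x y) =
      θ y * whitAux θ 0 x - whitAux θ 0 (innerL y x)) (by simp) ?_ ?_ (fun a ha => ?_) hx
    · intro x x' h h'; simp only [map_add, LinearMap.add_apply, h, h']; ring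
    · intro c x h; simp only [map_smul, LinearMap.smul_apply, h, smul_eq_mul]; ring
    refine treesWith_induction (p := fun y => whitAux θ 1 (gr (e a) y) =
      θ y * whitAux θ 0 (e a) - whitAux θ 0 (innerL y (e a))) (by simp) ?_ ?_ (fun b _ => ?_)
      (mem_treesWith_true y)
    · intro x x' h h'; simp only [map_add, LinearMap.add_apply, h, h']; ring
    · intro c x h; simp only [map_smul, LinearMap.smul_apply, h, smul_eq_mul]; ring
    rw [gr_single, innerL_e]
    obtain ⟨a', b', h, h'⟩ := exists_whitAux_graft θ 0 a b
    rcases RTree.graft_eq_graft h with ⟨rfl, rfl⟩ | ⟨c, rfl, -⟩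
    · exact h'
    · rw [RTree.rdeg_graft] at ha; omega
  | succ n ih =>
    refine treesWith_induction (p := fun x => whitAux θ (n + 2) (gr x y) =
      θ y * whitAux θ (n + 1) x - whitAux θ (n + 1) (innerL y x)) (by simp) ?_ ?_
      (fun a ha => ?_) hx
    · intro x x' h h'; simp only [map_add, LinearMap.add_apply, h, h']; ring
    · intro c x h; simp only [map_smul, LinearMap.smul_apply, h, smul_eq_mul]; ring
    refine treesWith_induction (p := fun y => whitAux θ (n + 2) (gr (e a) y) =
      θ y * whitAux θ (n + 1) (e a) - whitAux θ (n + 1) (innerL y (e a))) (by simp) ?_ ?_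
      (fun b _ => ?_) (mem_treesWith_true y)
    · intro x x' h h'; simp only [map_add, LinearMap.add_apply, h, h']; ring
    · intro c x h; simp only [map_smul, LinearMap.smul_apply, h, smul_eq_mul]; ring
    rw [gr_single, innerL_e]
    obtain ⟨a', b', h, h'⟩ := exists_whitAux_graft θ (n + 1) a b
    rcases RTree.graft_eq_graft h with ⟨rfl, rfl⟩ | ⟨c, rfl, rfl⟩
    · exact h'
    rw [h']
    have hc : e c ∈ treesWith fun t => t.rdeg = n := e_mem_treesWith (by
      rw [RTree.rdeg_graft] at ha; omega)
    have key : ∀ b b' : RTree, θ (e b) * whitAux θ (n + 1) (e (RTree.graft c b')) -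
        whitAux θ (n + 1) (innerP b (e (RTree.graft c b'))) =
        θ (e b) * (θ (e b') * whitAux θ n (e c) - whitAux θ n (innerP b' (e c))) -
        (θ (e b') * whitAux θ n (innerP b (e c)) - whitAux θ n (innerP b' (innerP b (e c))) +
          (θ (ins b b') * whitAux θ n (e c) - whitAux θ n (innerL (ins b b') (e c)))) := by
      intro b b'
      rw [← gr_single, innerP_gr, map_add, ih hc, ih hc, ih (innerP_mem_rdeg b hc), innerL_e, opP_e]
    rw [key, key, hθ b' b]
    have h1 := congrArg (whitAux θ n) (innerL_sub_ins b b' (e c))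
    rw [map_sub, map_sub] at h1
    linear_combination -h1

/-- The Whittaker functional on trees. -/
noncomputable def whit (θ : Tr →ₗ[ℂ] ℂ) : Tr →ₗ[ℂ] ℂ :=
  Finsupp.lsum ℂ fun t => LinearMap.toSpanSingleton ℂ _ (whitAux θ t.rdeg (e t))

theorem whit_e (θ : Tr →ₗ[ℂ] ℂ) (t : RTree) : whit θ (e t) = whitAux θ t.rdeg (e t) := by
  simp [whit, e]

theorem whit_of_rdeg (θ : Tr →ₗ[ℂ] ℂ) {n : ℕ} {x : Tr} (hx : x ∈ treesWith fun t => t.rdeg = n) :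
    whit θ x = whitAux θ n x := by
  refine treesWith_induction (p := fun x => whit θ x = whitAux θ n x) (by simp) ?_ ?_
    (fun a ha => by rw [whit_e, ha]) hx
  · intro x x' h h'; simp only [map_add, h, h']
  · intro c x h; simp only [map_smul, h]

theorem whit_leaf (θ : Tr →ₗ[ℂ] ℂ) : whit θ (e RTree.leaf) = 1 := by
  rw [whit_e, RTree.rdeg_leaf, whitAux]
  simp [e]

theorem whit_opP {θ : Tr →ₗ[ℂ] ℂ} (hθ : ∀ s t, θ (ins s t) = θ (ins t s)) (t : RTree) (x : Tr) :
    whit θ (opP t x) = θ (e t) * whit θ x := by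
  have h : whit θ ∘ₗ opP t = θ (e t) • whit θ := by
    refine Tr.hom_ext fun a => ?_
    have ha : e a ∈ treesWith fun t => t.rdeg = a.rdeg := e_mem_treesWith rfl
    have h1 : opP t (e a) = gr (e a) (e t) + innerP t (e a) := by rw [innerP_apply]; abel
    rw [LinearMap.comp_apply, h1, map_add, whit_of_rdeg θ (gr_mem_rdeg ha _),
      whit_of_rdeg θ (innerP_mem_rdeg t ha), whitAux_gr hθ _ ha, innerL_e, LinearMap.smul_apply,
      whit_of_rdeg θ ha, smul_eq_mul]
    ring
  exact congrArg (fun F => F x) h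

theorem whit_gr_leaf {θ : Tr →ₗ[ℂ] ℂ} (hθ : ∀ s t, θ (ins s t) = θ (ins t s)) (x : Tr) :
    whit θ (gr (e RTree.leaf) x) = θ x := by
  have h : whit θ ∘ₗ gr (e RTree.leaf) = θ := by
    refine Tr.hom_ext fun a => ?_
    rw [LinearMap.comp_apply, ← ins_leaf, ← opP_e, whit_opP hθ, whit_leaf, mul_one]
  exact congrArg (fun F => F x) h

theorem eq_zero_of_opP {N : Type*} [AddCommGroup N] [Module ℂ N] {θ : Tr →ₗ[ℂ] ℂ}
    {φ : Tr →ₗ[ℂ] N} (h0 : φ (e RTree.leaf) = 0) (h : ∀ t x, φ (opP t x) = θ (e t) • φ x) :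
    φ = 0 := by
  have key : ∀ n, ∀ x ∈ treesWith fun t => t.rdeg = n, φ x ∈ (⊥ : Submodule ℂ N) := by
    intro n
    induction n with
    | zero =>
      intro x hx
      refine map_mem_of_treesWith (fun a ha => ?_) hx
      by_cases hl : a = RTree.leaf
      · rw [hl, h0]; exact Submodule.zero_mem _
      · obtain ⟨b, c, rfl⟩ := RTree.exists_graft_of_ne_leaf hl
        rw [RTree.rdeg_graft] at ha; omega
    | succ n ih =>
      intro x hx
      refine map_mem_of_treesWith (fun a ha => ?_) hx
      obtain ⟨b, c, rfl⟩ := RTree.exists_graft_of_ne_leaf (t := a) (by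
        rintro rfl; rw [RTree.rdeg_leaf] at ha; omega)
      have hb : e b ∈ treesWith fun t => t.rdeg = n := e_mem_treesWith (by
        rw [RTree.rdeg_graft] at ha; omega)
      have h1 : e (RTree.graft b c) = opP c (e b) - innerP c (e b) := by
        rw [innerP_apply, gr_single]; abel
      rw [h1, map_sub, h]
      exact Submodule.sub_mem _ (Submodule.smul_mem _ _ (ih _ hb)) (ih _ (innerP_mem_rdeg c hb))
  exact Tr.hom_ext fun a => (Submodule.mem_bot ℂ).1 (key _ _ (e_mem_treesWith rfl))

end InsElim

namespace InsElim

open Polynomial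

theorem universalEnveloping_induction {L : Type*} [LieRing L] [LieAlgebra ℂ L]
    {p : UniversalEnvelopingAlgebra ℂ L → Prop} (hc : ∀ c : ℂ, p (algebraMap ℂ _ c))
    (hι : ∀ x, p (UniversalEnvelopingAlgebra.ι ℂ x)) (ha : ∀ a b, p a → p b → p (a + b))
    (hm : ∀ a b, p a → p b → p (a * b)) (a : UniversalEnvelopingAlgebra ℂ L) : p a := by
  let S : Subalgebra ℂ (UniversalEnvelopingAlgebra ℂ L) :=
    { carrier := {a | p a}
      mul_mem' := fun h h' => hm _ _ h h'
      add_mem' := fun h h' => ha _ _ h h'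
      algebraMap_mem' := hc }
  let g : L →ₗ⁅ℂ⁆ S :=
    { toFun := fun x => ⟨UniversalEnvelopingAlgebra.ι ℂ x, hι x⟩
      map_add' := fun x y => Subtype.ext (by simp)
      map_smul' := fun c x => Subtype.ext (by simp)
      map_lie' := fun {x y} => Subtype.ext (by simp [LieRing.of_associative_ring_bracket]) }
  have h : S.val.comp (UniversalEnvelopingAlgebra.lift ℂ g) = AlgHom.id ℂ _ := by
    apply UniversalEnvelopingAlgebra.hom_ext
    ext x
    simp [g]
  rw [← AlgHom.id_apply (R := ℂ) a, ← h]
  exact (UniversalEnvelopingAlgebra.lift ℂ g a).2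

/-- The functionals on trees with values in the polynomials in the lowest weight. -/
abbrev PolyDual : Type := Tr →ₗ[ℂ] ℂ[X]

/-- The action of `𝔤` on functionals, contragredient to `act + (X - 1) defAct`. -/
noncomputable def coAct : Alg →ₗ[ℂ] PolyDual →ₗ[ℂ] PolyDual :=
  LinearMap.mk₂ ℂ (fun x φ => -(φ ∘ₗ act x + LinearMap.mulLeft ℂ (X - 1) ∘ₗ φ ∘ₗ defAct x))
    (fun x y φ => by ext1 u; refine LinearMap.ext_ring ?_; simp; ring)
    (fun c x φ => by ext1 u; refine LinearMap.ext_ring ?_; simp)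
    (fun x φ ψ => by ext1 u; refine LinearMap.ext_ring ?_; simp; ring)
    (fun c x φ => by ext1 u; refine LinearMap.ext_ring ?_; simp)

theorem coAct_apply (x : Alg) (φ : PolyDual) (u : Tr) :
    coAct x φ u = -(φ (act x u) + (X - 1) * φ (defAct x u)) := rfl

theorem coAct_br (x y : Alg) (φ : PolyDual) :
    coAct (br x y) φ = coAct x (coAct y φ) - coAct y (coAct x φ) := by
  refine LinearMap.ext fun u => ?_
  have h1 := congrArg φ (congrArg (fun F => F u) (defAct_comm x y))
  simp only [cm_apply, LinearMap.zero_apply, map_sub, map_zero] at h1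
  rw [LinearMap.sub_apply]
  simp only [coAct_apply, act_br, defAct_br, cm_apply, LinearMap.add_apply, map_add, map_sub]
  linear_combination (X - 1) ^ 2 * h1

/-- `coAct` as a representation of `U(𝔤)`. -/
noncomputable def coRep : Ug →ₐ[ℂ] Module.End ℂ PolyDual :=
  UniversalEnvelopingAlgebra.lift ℂ
    { coAct with
      map_lie' := fun {x y} => LinearMap.ext fun φ => coAct_br x y φ }

theorem coRep_ι (x : Alg) (φ : PolyDual) :
    coRep (UniversalEnvelopingAlgebra.ι ℂ x) φ = coAct x φ := by
  rw [coRep, UniversalEnvelopingAlgebra.lift_ι_apply]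
  rfl

/-- The linear embedding `t ↦ D_t⁺` into `𝔫⁺`. -/
noncomputable def nPlusL : Tr →ₗ[ℂ] nPlus :=
  Finsupp.lsum ℂ fun t => LinearMap.toSpanSingleton ℂ _ (nPlusD t)

theorem nPlusL_e (t : RTree) : nPlusL (e t) = nPlusD t := by simp [nPlusL, e]

theorem coe_nPlusL (x : Tr) : (nPlusL x : Alg) = DpL x := by
  have h : nPlus.toSubmodule.subtype ∘ₗ nPlusL = DpL := Tr.hom_ext fun t => by
    rw [LinearMap.comp_apply, nPlusL_e, DpL_e]; rfl
  exact congrArg (fun F => F x) h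

theorem exists_nPlusL_eq (x : nPlus) : ∃ y, nPlusL y = x := by
  obtain ⟨x, hx⟩ := x
  have hx' : x ∈ Submodule.span ℂ (Set.range Dp) := hx
  obtain ⟨c, rfl⟩ := (Finsupp.mem_span_range_iff_exists_finsupp).1 hx'
  refine ⟨c, Subtype.ext ?_⟩
  rw [coe_nPlusL]
  simp [DpL, Finsupp.sum]

variable (η : nPlus →ₗ⁅ℂ⁆ ℂ)

/-- The functional `t ↦ -η(D_t⁺)` on trees. -/
noncomputable def weight : Tr →ₗ[ℂ] ℂ := -((η : nPlus →ₗ[ℂ] ℂ) ∘ₗ nPlusL)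

theorem weight_apply (x : Tr) : weight η x = -η (nPlusL x) := rfl

theorem weight_e (t : RTree) : weight η (e t) = -η (nPlusD t) := by rw [weight_apply, nPlusL_e]

theorem weight_ins (s t : RTree) : weight η (ins s t) = weight η (ins t s) := by
  rw [← sub_eq_zero, ← map_sub, weight_apply, neg_eq_zero]
  have h : nPlusL (ins s t - ins t s) = ⁅nPlusD s, nPlusD t⁆ := by
    refine Subtype.ext ?_
    rw [coe_nPlusL, ← brBasis_plus_plus, LieSubalgebra.coe_bracket]
    exact (lie_basis (.plus s) (.plus t)).symm
  rw [h, LieHom.map_lie, LieRing.of_associative_ring_bracket, mul_comm, sub_self]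

/-- The Whittaker functional as a vector in `PolyDual`. -/
noncomputable def whitDual : PolyDual := Algebra.linearMap ℂ ℂ[X] ∘ₗ whit (weight η)

theorem whitDual_apply (u : Tr) : whitDual η u = C (whit (weight η) u) := rfl

theorem coAct_nPlus_whitDual (x : nPlus) : coAct x (whitDual η) = η x • whitDual η := by
  obtain ⟨y, rfl⟩ := exists_nPlusL_eq x
  have h : coAct.flip (whitDual η) ∘ₗ DpL =
      ((η : nPlus →ₗ[ℂ] ℂ) ∘ₗ nPlusL).smulRight (whitDual η) := by
    refine Tr.hom_ext fun t => LinearMap.ext fun u => ?_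
    simp only [LinearMap.comp_apply, LinearMap.flip_apply, DpL_e, LinearMap.smulRight_apply,
      nPlusL_e, LinearMap.smul_apply, coAct_apply, act_Dp, defAct_Dp, LinearMap.zero_apply,
      map_zero, mul_zero, add_zero, whitDual_apply]
    rw [whit_opP (weight_ins η), weight_e, Polynomial.smul_C, ← map_neg]
    simp
  rw [coe_nPlusL]
  exact congrArg (fun F => F y) h

theorem coRep_UnToUg_whitDual (a : Un) :
    coRep (UnToUg a) (whitDual η) = etaU η a • whitDual η := by
  induction a using universalEnveloping_induction with
  | hc c => simp [Algebra.algebraMap_eq_smul_one]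
  | hι x =>
    rw [UnToUg, etaU, UniversalEnvelopingAlgebra.lift_ι_apply,
      UniversalEnvelopingAlgebra.lift_ι_apply, ← coAct_nPlus_whitDual]
    exact coRep_ι _ _
  | ha a b ha hb => simp [ha, hb, add_smul]
  | hm a b ha hb =>
    rw [map_mul, map_mul, Module.End.mul_apply, hb, map_smul, ha, smul_smul, map_mul, mul_comm]

open scoped TensorProduct

/-- The map `u ⊗ z ↦ z u f` for the Whittaker functional `f`. -/
noncomputable def toDualAux : Ug ⊗[ℂ] ℂ →ₗ[ℂ] PolyDual :=
  (coRep.toLinearMap.flip (whitDual η)) ∘ₗ (TensorProduct.rid ℂ Ug).toLinearMap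

theorem toDualAux_tmul (u : Ug) (z : ℂ) : toDualAux η (u ⊗ₜ z) = z • coRep u (whitDual η) := by
  simp [toDualAux]

theorem toDualAux_smul (u : Ug) (w : Ug ⊗[ℂ] ℂ) :
    toDualAux η (u • w) = coRep u (toDualAux η w) := by
  induction w using TensorProduct.induction_on with
  | zero => simp
  | tmul a z => rw [TensorProduct.smul_tmul', toDualAux_tmul, toDualAux_tmul]; simp
  | add a b ha hb => simp [smul_add, ha, hb]

theorem toDualAux_balanced {w : Ug ⊗[ℂ] ℂ} (hw : w ∈ balanced η) : toDualAux η w = 0 := by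
  induction hw using Submodule.span_induction with
  | mem w h =>
    obtain ⟨u, a, z, rfl⟩ := h
    rw [map_sub, toDualAux_tmul, toDualAux_tmul, map_mul, Module.End.mul_apply,
      coRep_UnToUg_whitDual, map_smul, smul_smul, mul_comm, sub_self]
  | zero => exact map_zero _
  | add a b _ _ ha hb => rw [map_add, ha, hb, add_zero]
  | smul u a _ ha => rw [toDualAux_smul, ha, map_zero]

/-- The homomorphism from the Whittaker module to the functionals on trees. -/
noncomputable def toDual : Whittaker η →ₗ[ℂ] PolyDual :=
  ((balanced η).restrictScalars ℂ).liftQ (toDualAux η) (fun _ hw => toDualAux_balanced η hw) ∘ₗ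
    (Submodule.Quotient.restrictScalarsEquiv ℂ (balanced η)).symm.toLinearMap

theorem toDual_mk (w : Ug ⊗[ℂ] ℂ) :
    toDual η (Submodule.Quotient.mk w) = toDualAux η w := rfl

theorem toDual_smul (u : Ug) (w : Whittaker η) : toDual η (u • w) = coRep u (toDual η w) := by
  obtain ⟨w, rfl⟩ := Submodule.Quotient.mk_surjective _ w
  rw [← Submodule.Quotient.mk_smul, toDual_mk, toDual_mk, toDualAux_smul]

/-- The generator of the Whittaker module. -/
noncomputable def gen : Whittaker η := Submodule.Quotient.mk (1 ⊗ₜ 1)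

theorem toDual_gen : toDual η (gen η) = whitDual η := by
  rw [gen, toDual_mk, toDualAux_tmul]; simp

theorem gen_ne_zero : gen η ≠ 0 := by
  intro h
  have h1 := congrArg (fun φ : PolyDual => φ (e RTree.leaf)) (congrArg (toDual η) h)
  simp [toDual_gen, whitDual_apply, whit_leaf] at h1

theorem exists_smul_gen (w : Whittaker η) : ∃ u : Ug, w = u • gen η := by
  obtain ⟨w, rfl⟩ := Submodule.Quotient.mk_surjective _ w
  refine ⟨TensorProduct.rid ℂ Ug w, ?_⟩
  rw [gen, ← Submodule.Quotient.mk_smul]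
  congr 1
  induction w using TensorProduct.induction_on with
  | zero => simp
  | tmul a z => rw [TensorProduct.smul_tmul', TensorProduct.rid_tmul, smul_eq_mul, mul_one,
      TensorProduct.smul_tmul, smul_eq_mul, mul_one]
  | add a b ha hb => rw [map_add, add_smul, ← ha, ← hb]

theorem nPlus_smul_gen (x : nPlus) :
    UniversalEnvelopingAlgebra.ι ℂ (x : Alg) • gen η = η x • gen η := by
  have h : (UniversalEnvelopingAlgebra.ι ℂ (x : Alg) : Ug) =
      1 * UnToUg (UniversalEnvelopingAlgebra.ι ℂ x) := by
    rw [one_mul, UnToUg, UniversalEnvelopingAlgebra.lift_ι_apply]; rfl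
  have h1 : η x • gen η = Submodule.Quotient.mk (1 ⊗ₜ (etaU η (UniversalEnvelopingAlgebra.ι ℂ x) * 1)) := by
    rw [etaU, UniversalEnvelopingAlgebra.lift_ι_apply, gen, ← Submodule.Quotient.mk_smul,
      mul_one, TensorProduct.smul_tmul', TensorProduct.smul_tmul, smul_eq_mul, mul_one]
  rw [h1, gen, ← Submodule.Quotient.mk_smul, Submodule.Quotient.eq, TensorProduct.smul_tmul',
    smul_eq_mul, mul_one, h]
  exact Submodule.subset_span ⟨1, _, 1, rfl⟩

end InsElim

namespace InsElim

section
variable (η : nPlus →ₗ⁅ℂ⁆ ℂ)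

/-- The action of `𝔤` on the Whittaker module. -/
noncomputable def lieOp : Alg →ₗ[ℂ] Module.End ℂ (Whittaker η) :=
  (Algebra.lsmul ℂ ℂ (Whittaker η)).toLinearMap ∘ₗ
    ((UniversalEnvelopingAlgebra.ι ℂ : Alg →ₗ⁅ℂ⁆ Ug) : Alg →ₗ[ℂ] Ug)

theorem lieOp_apply (x : Alg) (w : Whittaker η) :
    lieOp η x w = (UniversalEnvelopingAlgebra.ι ℂ x : Ug) • w := rfl

theorem lieOp_br (x y : Alg) : lieOp η (br x y) = lieOp η x * lieOp η y - lieOp η y * lieOp η x := by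
  refine LinearMap.ext fun w => ?_
  change (UniversalEnvelopingAlgebra.ι ℂ ⁅x, y⁆ : Ug) • w = _
  rw [LieHom.map_lie, LieRing.of_associative_ring_bracket, sub_smul, mul_smul, mul_smul]
  rfl

theorem lieOp_comm (i j : Index) (w : Whittaker η) : lieOp η (basis i) (lieOp η (basis j) w) =
    lieOp η (basis j) (lieOp η (basis i) w) + lieOp η (brBasis i j) w := by
  rw [← br_basis, lieOp_br, LinearMap.sub_apply, Module.End.mul_apply, Module.End.mul_apply]
  abel

theorem semiconj_Dm_dd (s : RTree) : SemiconjBy (lieOp η (Dm s)) (lieOp η dd)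
    (lieOp η dd + (s.size : ℂ) • 1) := by
  refine LinearMap.ext fun w => ?_
  have h := lieOp_comm η (.minus s) .d w
  rw [brBasis, map_smul] at h
  exact h

theorem semiconj_Dp_dd (s : RTree) : SemiconjBy (lieOp η (Dp s)) (lieOp η dd)
    (lieOp η dd + (-(s.size : ℂ)) • 1) := by
  refine LinearMap.ext fun w => ?_
  have h := lieOp_comm η (.plus s) .d w
  rw [brBasis, ← neg_smul, map_smul] at h
  exact h

/-- `D_{s₁}⁻ ⋯ D_{sₖ}⁻ v` for the generator `v`. -/
noncomputable def vec : List RTree → Whittaker η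
  | [] => gen η
  | s :: L => lieOp η (Dm s) (vec L)

/-- `dʲ D_{s₁}⁻ ⋯ D_{sₖ}⁻ v` for the generator `v`. -/
noncomputable def word (j : ℕ) (L : List RTree) : Whittaker η := (lieOp η dd ^ j) (vec η L)

theorem word_succ (j : ℕ) (L : List RTree) : word η (j + 1) L = lieOp η dd (word η j L) := by
  rw [word, pow_succ']; rfl

/-- The total number of vertices in a list of trees. -/
def listSize (L : List RTree) : ℕ := (L.map RTree.size).sum

theorem listSize_cons (s : RTree) (L : List RTree) : listSize (s :: L) = s.size + listSize L := rfl

/-- The span of the words of total size and `d`-degree lexicographically below `(n, J)`. -/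
noncomputable def lexSpan (n J : ℕ) : Submodule ℂ (Whittaker η) :=
  Submodule.span ℂ {w | ∃ j L, (listSize L < n ∨ listSize L = n ∧ j < J) ∧ w = word η j L}

theorem word_mem_lexSpan {n J j : ℕ} {L : List RTree}
    (h : listSize L < n ∨ listSize L = n ∧ j < J) : word η j L ∈ lexSpan η n J :=
  Submodule.subset_span ⟨j, L, h, rfl⟩

theorem map_mem_of_lexSpan {η} {F : Module.End ℂ (Whittaker η)} {V : Submodule ℂ (Whittaker η)}
    {n J : ℕ} (h : ∀ j L, (listSize L < n ∨ listSize L = n ∧ j < J) → F (word η j L) ∈ V)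
    {w : Whittaker η} (hw : w ∈ lexSpan η n J) : F w ∈ V := by
  have : lexSpan η n J ≤ V.comap F := by
    refine Submodule.span_le.2 ?_
    rintro _ ⟨j, L, hj, rfl⟩
    exact h j L hj
  exact this hw

theorem lexSpan_mono {n n' J J' : ℕ} (h : n < n' ∨ n = n' ∧ J ≤ J') :
    lexSpan η n J ≤ lexSpan η n' J' := by
  refine Submodule.span_mono ?_
  rintro _ ⟨j, L, hj, rfl⟩
  exact ⟨j, L, by omega, rfl⟩

theorem dd_mem_lexSpan {n J : ℕ} {w : Whittaker η} (hw : w ∈ lexSpan η n J) :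
    lieOp η dd w ∈ lexSpan η n (J + 1) := by
  refine map_mem_of_lexSpan (fun j L h => ?_) hw
  rw [← word_succ]
  exact word_mem_lexSpan η (by omega)

theorem dd_mem_lexSpan_zero {n : ℕ} {w : Whittaker η} (hw : w ∈ lexSpan η n 0) :
    lieOp η dd w ∈ lexSpan η n 0 := by
  refine map_mem_of_lexSpan (fun j L h => ?_) hw
  rw [← word_succ]
  exact word_mem_lexSpan η (by omega)

theorem dd_add_pow_mem_lexSpan_zero (q : ℂ) (j : ℕ) {n : ℕ} {w : Whittaker η}
    (hw : w ∈ lexSpan η n 0) : ((lieOp η dd + q • 1) ^ j) w ∈ lexSpan η n 0 := by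
  induction j with
  | zero => exact hw
  | succ j ih =>
    rw [pow_succ']
    exact Submodule.add_mem _ (dd_mem_lexSpan_zero η ih) (Submodule.smul_mem _ _ ih)

theorem dd_add_pow_sub_mem (q : ℂ) (j : ℕ) (L : List RTree) :
    ((lieOp η dd + q • 1) ^ j) (vec η L) - word η j L ∈ lexSpan η (listSize L) j := by
  induction j with
  | zero => simp [word]
  | succ j ih =>
    have h : ((lieOp η dd + q • 1) ^ (j + 1)) (vec η L) - word η (j + 1) L =
        (lieOp η dd (((lieOp η dd + q • 1) ^ j) (vec η L) - word η j L) +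
        q • (((lieOp η dd + q • 1) ^ j) (vec η L) - word η j L)) + q • word η j L := by
      rw [pow_succ', Module.End.mul_apply, word_succ]
      simp only [LinearMap.add_apply, LinearMap.smul_apply, Module.End.one_apply, map_sub, smul_sub]
      abel
    rw [h]
    exact Submodule.add_mem _ (Submodule.add_mem _ (dd_mem_lexSpan η ih) (Submodule.smul_mem _ _
      (lexSpan_mono η (by omega) ih))) (Submodule.smul_mem _ _ (word_mem_lexSpan η (by omega)))

theorem Dm_word_mem_lexSpan (s : RTree) {j : ℕ} {L : List RTree} {n : ℕ}
    (h : listSize L + s.size < n) : lieOp η (Dm s) (word η j L) ∈ lexSpan η n 0 := by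
  have h1 : lieOp η (Dm s) (word η j L) =
      ((lieOp η dd + (s.size : ℂ) • 1) ^ j) (vec η (s :: L)) :=
    congrArg (fun F => F (vec η L)) ((semiconj_Dm_dd η s).pow_right j).eq
  rw [h1]
  refine dd_add_pow_mem_lexSpan_zero η _ _ ?_
  exact word_mem_lexSpan η (j := 0) (L := s :: L) (by rw [listSize_cons]; omega)

theorem Dm_mem_lexSpan (s : RTree) {n : ℕ} {w : Whittaker η} (hw : w ∈ lexSpan η n 0) :
    lieOp η (Dm s) w ∈ lexSpan η (s.size + n) 0 := by
  refine map_mem_of_lexSpan (fun j L h => ?_) hw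
  exact Dm_word_mem_lexSpan η s (by omega)

theorem Dp_gen (t : RTree) : lieOp η (Dp t) (gen η) = η (nPlusD t) • gen η :=
  nPlus_smul_gen η (nPlusD t)

theorem map_DpL_mem {N : Type*} [AddCommGroup N] [Module ℂ N] {F : Alg →ₗ[ℂ] N}
    {V : Submodule ℂ N} (h : ∀ t, F (Dp t) ∈ V) (x : Tr) : F (DpL x) ∈ V :=
  map_mem_of_treesWith (F := F ∘ₗ DpL) (fun t _ => by
    rw [LinearMap.comp_apply, DpL_e]; exact h t) (mem_treesWith_true x)

theorem map_DmL_mem {N : Type*} [AddCommGroup N] [Module ℂ N] {F : Alg →ₗ[ℂ] N}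
    {V : Submodule ℂ N} {P : RTree → Prop} (h : ∀ t, P t → F (Dm t) ∈ V) {x : Tr}
    (hx : x ∈ treesWith P) : F (DmL x) ∈ V :=
  map_mem_of_treesWith (F := F ∘ₗ DmL) (fun t ht => by
    rw [LinearMap.comp_apply, DmL_e]; exact h t ht) hx

theorem Dp_vec_sub_mem (t : RTree) (L : List RTree) :
    lieOp η (Dp t) (vec η L) - η (nPlusD t) • vec η L ∈ lexSpan η (listSize L) 0 := by
  classical
  induction L generalizing t with
  | nil =>
    rw [vec, Dp_gen, sub_self]
    exact Submodule.zero_mem _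
  | cons s L ih =>
    have hs := s.size_pos
    have h0 : vec η L ∈ lexSpan η (s.size + listSize L) 0 :=
      word_mem_lexSpan η (j := 0) (by omega)
    have h1 : ∀ x, lieOp η (DpL x) (vec η L) ∈ lexSpan η (s.size + listSize L) 0 := fun x => by
      refine map_DpL_mem (F := (lieOp η).flip (vec η L)) (fun r => ?_) x
      have h2 := Submodule.add_mem _ (lexSpan_mono η (by omega) (ih r))
        (Submodule.smul_mem _ (η (nPlusD r)) h0)
      rw [sub_add_cancel] at h2
      exact h2
    have h2 : lieOp η (DmL (betaF s t)) (vec η L) ∈ lexSpan η (s.size + listSize L) 0 := by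
      refine map_DmL_mem (F := (lieOp η).flip (vec η L)) (P := fun r => r.size < s.size)
        (fun r hr => Dm_word_mem_lexSpan η r (j := 0) (by omega)) ?_
      rw [treesWith, Finsupp.mem_supported]
      intro r hr
      have hr' : betaF s t r ≠ 0 := Finsupp.mem_support_iff.1 hr
      rw [betaF_apply, Nat.cast_ne_zero] at hr'
      have := size_of_beta_ne_zero hr'
      have := t.size_pos
      change r.size < s.size
      omega
    have h3 : lieOp η (if t = s then dd else 0) (vec η L) ∈
        lexSpan η (s.size + listSize L) 0 := by
      split_ifs
      · exact dd_mem_lexSpan_zero η h0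
      · rw [map_zero]; exact Submodule.zero_mem _
    have h4 : lieOp η (Dp t) (vec η (s :: L)) - η (nPlusD t) • vec η (s :: L) =
        lieOp η (Dm s) (lieOp η (Dp t) (vec η L) - η (nPlusD t) • vec η L) -
          lieOp η (brMP s t) (vec η L) := by
      have h5 := lieOp_comm η (.plus t) (.minus s) (vec η L)
      rw [brBasis, map_neg, LinearMap.neg_apply] at h5
      rw [map_sub, map_smul]
      change lieOp η (Dp t) (lieOp η (Dm s) (vec η L)) = lieOp η (Dm s) (lieOp η (Dp t) (vec η L)) + _ at h5
      rw [vec, h5]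
      abel
    rw [h4, listSize_cons, brMP_eq, map_add, map_add, LinearMap.add_apply, LinearMap.add_apply]
    exact Submodule.sub_mem _ (Dm_mem_lexSpan η s (ih t))
      (Submodule.add_mem _ (Submodule.add_mem _ (h1 _) h2) h3)

theorem Dp_word_sub_mem (t : RTree) (j : ℕ) (L : List RTree) :
    lieOp η (Dp t) (word η j L) - η (nPlusD t) • word η j L ∈ lexSpan η (listSize L) j := by
  have h1 : lieOp η (Dp t) (word η j L) =
      ((lieOp η dd + (-(t.size : ℂ)) • 1) ^ j) (lieOp η (Dp t) (vec η L)) :=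
    congrArg (fun F => F (vec η L)) ((semiconj_Dp_dd η t).pow_right j).eq
  have h2 : lieOp η (Dp t) (word η j L) - η (nPlusD t) • word η j L =
      ((lieOp η dd + (-(t.size : ℂ)) • 1) ^ j)
        (lieOp η (Dp t) (vec η L) - η (nPlusD t) • vec η L) + η (nPlusD t) •
        (((lieOp η dd + (-(t.size : ℂ)) • 1) ^ j) (vec η L) - word η j L) := by
    rw [h1, map_sub, map_smul, smul_sub]
    abel
  rw [h2]
  exact Submodule.add_mem _ (lexSpan_mono η (by omega)
    (dd_add_pow_mem_lexSpan_zero η _ j (Dp_vec_sub_mem η t L)))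
    (Submodule.smul_mem _ _ (dd_add_pow_sub_mem η _ j L))

theorem Dp_sub_mem_lexSpan (t : RTree) {n J : ℕ} {w : Whittaker η}
    (hw : w ∈ lexSpan η n (J + 1)) :
    lieOp η (Dp t) w - η (nPlusD t) • w ∈ lexSpan η n J := by
  refine map_mem_of_lexSpan (F := lieOp η (Dp t) - η (nPlusD t) • 1) (fun j L h => ?_) hw
  exact lexSpan_mono η (by omega) (Dp_word_sub_mem η t j L)

theorem span_words : Submodule.span ℂ {w | ∃ j L, w = word η j L} = ⊤ := by
  set V := Submodule.span ℂ {w | ∃ j L, w = word η j L} with hV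
  have hmap : ∀ F : Module.End ℂ (Whittaker η), (∀ j L, F (word η j L) ∈ V) →
      ∀ w ∈ V, F w ∈ V := by
    intro F h w hw
    have : V ≤ V.comap F := by
      rw [hV]
      refine Submodule.span_le.2 ?_
      rintro _ ⟨j, L, rfl⟩
      exact h j L
    exact this hw
  have hle : ∀ n J, lexSpan η n J ≤ V := by
    intro n J
    refine Submodule.span_mono ?_
    rintro _ ⟨j, L, _, rfl⟩
    exact ⟨j, L, rfl⟩
  have hword : ∀ j L, word η j L ∈ V := fun j L => Submodule.subset_span ⟨j, L, rfl⟩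
  have hbasis : ∀ x : Alg, ∀ w ∈ V, lieOp η x w ∈ V := by
    intro x
    induction x using Alg.induction with
    | h0 => intro w _; rw [map_zero]; exact Submodule.zero_mem _
    | ha x y hx hy =>
      intro w hw; rw [map_add]; exact Submodule.add_mem _ (hx w hw) (hy w hw)
    | hs c x hx => intro w hw; rw [map_smul]; exact Submodule.smul_mem _ _ (hx w hw)
    | hb i =>
      refine hmap _ fun j L => ?_
      rcases i with _ | t | t
      · exact word_succ η j L ▸ hword _ _
      · have h := Submodule.add_mem _ (hle _ _ (Dp_word_sub_mem η t j L))
          (Submodule.smul_mem _ (η (nPlusD t)) (hword j L))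
        rw [sub_add_cancel] at h
        exact h
      · exact hle _ _ (Dm_word_mem_lexSpan η t (Nat.lt_succ_self _))
  rw [eq_top_iff]
  intro w _
  obtain ⟨u, rfl⟩ := exists_smul_gen η w
  have hu : ∀ u : Ug, ∀ w ∈ V, u • w ∈ V := by
    intro u
    induction u using universalEnveloping_induction with
    | hc c => intro w hw; rw [algebraMap_smul]; exact Submodule.smul_mem _ _ hw
    | hι x => exact hbasis x
    | ha a b ha hb => intro w hw; rw [add_smul]; exact Submodule.add_mem _ (ha w hw) (hb w hw)
    | hm a b ha hb => intro w hw; rw [mul_smul]; exact ha _ (hb w hw)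
  exact hu _ _ (hword 0 [])

theorem exists_mem_lexSpan_of_succ {n : ℕ} {w : Whittaker η} (hw : w ∈ lexSpan η (n + 1) 0) :
    ∃ J, w ∈ lexSpan η n J := by
  induction hw using Submodule.span_induction with
  | mem w h =>
    obtain ⟨j, L, hL, rfl⟩ := h
    exact ⟨j + 1, word_mem_lexSpan η (by omega)⟩
  | zero => exact ⟨0, Submodule.zero_mem _⟩
  | add a b _ _ ha hb =>
    obtain ⟨J, hJ⟩ := ha
    obtain ⟨J', hJ'⟩ := hb
    exact ⟨J + J', Submodule.add_mem _ (lexSpan_mono η (by omega) hJ) (lexSpan_mono η (by omega) hJ')⟩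
  | smul c a _ ha =>
    obtain ⟨J, hJ⟩ := ha
    exact ⟨J, Submodule.smul_mem _ _ hJ⟩

theorem exists_mem_lexSpan (w : Whittaker η) : ∃ n, w ∈ lexSpan η n 0 := by
  have hw := Submodule.mem_top (R := ℂ) (x := w)
  rw [← span_words] at hw
  induction hw using Submodule.span_induction with
  | mem w h =>
    obtain ⟨j, L, rfl⟩ := h
    exact ⟨listSize L + 1, word_mem_lexSpan η (by omega)⟩
  | zero => exact ⟨0, Submodule.zero_mem _⟩
  | add a b _ _ ha hb =>
    obtain ⟨n, hn⟩ := ha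
    obtain ⟨n', hn'⟩ := hb
    exact ⟨n + n', Submodule.add_mem _ (lexSpan_mono η (by omega) hn) (lexSpan_mono η (by omega) hn')⟩
  | smul c a _ ha =>
    obtain ⟨n, hn⟩ := ha
    exact ⟨n, Submodule.smul_mem _ _ hn⟩

/-- `D_S⁻ v` for words of length less than `n`. -/
noncomputable def shortSpan (n : ℕ) : Submodule ℂ (Whittaker η) :=
  Submodule.span ℂ {w | ∃ L : List RTree, L.length < n ∧ w = vec η L}

theorem vec_mem_shortSpan {n : ℕ} {L : List RTree} (h : L.length < n) : vec η L ∈ shortSpan η n :=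
  Submodule.subset_span ⟨L, h, rfl⟩

theorem Dm_mem_shortSpan (s : RTree) {n : ℕ} {w : Whittaker η} (hw : w ∈ shortSpan η n) :
    lieOp η (Dm s) w ∈ shortSpan η (n + 1) := by
  have : shortSpan η n ≤ (shortSpan η (n + 1)).comap (lieOp η (Dm s)) := by
    refine Submodule.span_le.2 ?_
    rintro _ ⟨L, h, rfl⟩
    exact vec_mem_shortSpan η (L := s :: L) (by simpa using h)
  exact this hw

theorem vec_sub_vec_mem_of_perm {L L' : List RTree} (h : L.Perm L') :
    vec η L - vec η L' ∈ shortSpan η L.length := by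
  induction h with
  | nil => rw [sub_self]; exact Submodule.zero_mem _
  | cons s _ ih =>
    rw [vec, vec, ← map_sub]
    exact Dm_mem_shortSpan η s ih
  | swap a b L =>
    have h1 := lieOp_comm η (.minus b) (.minus a) (vec η L)
    rw [brBasis_minus_minus] at h1
    have h2 : vec η (b :: a :: L) - vec η (a :: b :: L) =
        lieOp η (DmL (alphaF a b - alphaF b a)) (vec η L) := by
      rw [sub_eq_iff_eq_add']
      exact h1
    rw [h2]
    exact map_DmL_mem (F := (lieOp η).flip (vec η L)) (P := fun _ => True)
      (fun r _ => vec_mem_shortSpan η (L := r :: L) (by simp)) (mem_treesWith_true _)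
  | trans h₁ _ ih₁ ih₂ =>
    rw [← h₁.length_eq] at ih₂
    have := Submodule.add_mem _ ih₁ ih₂
    rwa [sub_add_sub_cancel] at this

theorem vec_mem_span_multiset (L : List RTree) :
    vec η L ∈ Submodule.span ℂ (Set.range fun S : Multiset RTree => vec η S.toList) := by
  induction hn : L.length using Nat.strong_induction_on generalizing L with
  | h n ih =>
    have h1 : shortSpan η n ≤
        Submodule.span ℂ (Set.range fun S : Multiset RTree => vec η S.toList) := by
      refine Submodule.span_le.2 ?_
      rintro _ ⟨L', h, rfl⟩
      exact ih _ h L' rfl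
    have hp : L.Perm (L : Multiset RTree).toList :=
      (Multiset.coe_eq_coe.1 (Multiset.coe_toList _)).symm
    have h2 := h1 (hn ▸ vec_sub_vec_mem_of_perm η hp)
    have h3 := Submodule.add_mem _ h2 (Submodule.subset_span ⟨(L : Multiset RTree), rfl⟩)
    simpa using h3

theorem exists_finsupp_eq (w : Whittaker η) : ∃ c : Multiset RTree × ℕ →₀ ℂ,
    w = c.sum fun p a => a • word η p.2 p.1.toList := by
  have h : (⊤ : Submodule ℂ (Whittaker η)) ≤
      Submodule.span ℂ (Set.range fun p : Multiset RTree × ℕ => word η p.2 p.1.toList) := by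
    rw [← span_words]
    refine Submodule.span_le.2 ?_
    rintro _ ⟨j, L, rfl⟩
    have h1 : Submodule.span ℂ (Set.range fun S : Multiset RTree => vec η S.toList) ≤
        (Submodule.span ℂ (Set.range fun p : Multiset RTree × ℕ =>
          word η p.2 p.1.toList)).comap (lieOp η dd ^ j) := by
      refine Submodule.span_le.2 ?_
      rintro _ ⟨S, rfl⟩
      exact Submodule.subset_span ⟨(S, j), rfl⟩
    exact h1 (vec_mem_span_multiset η L)
  obtain ⟨c, hc⟩ := Finsupp.mem_span_range_iff_exists_finsupp.1 (h (Submodule.mem_top (x := w)))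
  exact ⟨c, hc.symm⟩

end

end InsElim

namespace InsElim

open Polynomial

/-- The composition of the operators `rootM s` over a list of trees. -/
noncomputable def rootMs : List RTree → Module.End ℂ Tr
  | [] => 1
  | s :: L => rootMs L * rootM s

/-- The composition of the operators `opM s` over a list of trees. -/
noncomputable def opMs : List RTree → Module.End ℂ Tr
  | [] => 1
  | s :: L => opMs L * opM s

open Classical in
/-- The product of the factorials of the multiplicities. -/
noncomputable def symFactor (C : Multiset RTree) : ℕ := ∏ a ∈ C.toFinset, (C.count a).factorial

theorem symFactor_ne_zero (C : Multiset RTree) : symFactor C ≠ 0 :=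
  Finset.prod_ne_zero_iff.2 fun _ _ => Nat.factorial_ne_zero _

open Classical in
theorem symFactor_cons (s : RTree) (C : Multiset RTree) :
    symFactor (s ::ₘ C) = (C.count s + 1) * symFactor C := by
  have h1 : symFactor C = ∏ a ∈ insert s C.toFinset, (C.count a).factorial := by
    refine Finset.prod_subset (Finset.subset_insert _ _) fun a _ ha => ?_
    rw [Multiset.count_eq_zero_of_notMem (by simpa using ha), Nat.factorial_zero]
  have hs : s ∈ insert s C.toFinset := Finset.mem_insert_self _ _
  rw [h1, symFactor, Multiset.toFinset_cons, ← Finset.mul_prod_erase _ _ hs,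
    ← Finset.mul_prod_erase _ _ hs, Multiset.count_cons_self, Nat.factorial_succ, mul_assoc]
  congr 2
  refine Finset.prod_congr rfl fun a ha => ?_
  rw [Multiset.count_cons_of_ne (Finset.ne_of_mem_erase ha)]

open Classical in
theorem rootMs_join (L : List RTree) (C : Multiset RTree) : rootMs L (e (RTree.join C)) =
    if (L : Multiset RTree) ≤ C then
      ((symFactor C : ℂ) / symFactor (C - L)) • e (RTree.join (C - L)) else 0 := by
  induction L generalizing C with
  | nil =>
    have h : (symFactor C : ℂ) ≠ 0 := Nat.cast_ne_zero.2 (symFactor_ne_zero C)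
    simp [rootMs, h]
  | cons s L ih =>
    rw [rootMs, Module.End.mul_apply, rootM_e, RTree.branches_join, map_smul, ih,
      ← Multiset.cons_coe]
    by_cases hs : s ∈ C
    · obtain ⟨D, rfl⟩ := Multiset.exists_cons_of_mem hs
      rw [Multiset.erase_cons_head, Multiset.sub_cons, Multiset.erase_cons_head,
        Multiset.count_cons_self, symFactor_cons]
      simp only [Multiset.cons_le_cons_iff]
      split_ifs
      · rw [smul_smul]; push_cast; rw [mul_div_assoc]
      · rw [smul_zero]
    · have h : ¬ s ::ₘ (L : Multiset RTree) ≤ C :=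
        fun h => hs (Multiset.mem_of_le h (Multiset.mem_cons_self _ _))
      rw [Multiset.count_eq_zero_of_notMem hs, if_neg h, Nat.cast_zero, zero_smul]

theorem rootMs_leaf {L : List RTree} (h : L ≠ []) : rootMs L (e RTree.leaf) = 0 := by
  cases L with
  | nil => exact absurd rfl h
  | cons s L => rw [rootMs, Module.End.mul_apply, rootM_leaf, map_zero]

theorem coAct_dd_pow (j : ℕ) (φ : PolyDual) (t : RTree) :
    ((coAct dd : Module.End ℂ PolyDual) ^ j) φ (e t) =
      (-(X + C ((t.size : ℂ) - 1))) ^ j * φ (e t) := by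
  induction j with
  | zero => simp
  | succ j ih =>
    rw [pow_succ', Module.End.mul_apply, coAct_apply, act_dd, opD_e, defAct_dd, map_smul,
      Module.End.one_apply, ih, Polynomial.smul_eq_C_mul, C_sub, C_1]
    ring

section
variable (θ : Tr →ₗ[ℂ] ℂ)

/-- The functional `D_{s₁}⁻ ⋯ D_{sₖ}⁻ f` for the Whittaker functional `f`. -/
noncomputable def wordDual : List RTree → PolyDual
  | [] => Algebra.linearMap ℂ ℂ[X] ∘ₗ whit θ
  | s :: L => coAct (Dm s) (wordDual L)

theorem wordDual_nil (x : Tr) : wordDual θ [] x = C (whit θ x) := rfl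

theorem wordDual_cons (s : RTree) (L : List RTree) (x : Tr) : wordDual θ (s :: L) x =
    -(wordDual θ L (opM s x) + (X - 1) * wordDual θ L (rootM s x)) := by
  rw [wordDual, coAct_apply, act_Dm, defAct_Dm]

theorem natDegree_wordDual (L : List RTree) (x : Tr) : (wordDual θ L x).natDegree ≤ L.length := by
  induction L generalizing x with
  | nil => rw [wordDual_nil, natDegree_C]; exact Nat.zero_le _
  | cons s L ih =>
    rw [wordDual_cons, natDegree_neg, List.length_cons]
    refine natDegree_add_le_of_degree_le ((ih _).trans (Nat.le_succ _)) ?_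
    refine natDegree_mul_le.trans ?_
    have h1 : (X - 1 : ℂ[X]).natDegree ≤ 1 := natDegree_X_sub_C_le (1 : ℂ)
    have := ih (rootM s x)
    omega

theorem coeff_wordDual (L : List RTree) (x : Tr) :
    (wordDual θ L x).coeff L.length = (-1) ^ L.length * whit θ (rootMs L x) := by
  induction L generalizing x with
  | nil => simp [wordDual_nil, rootMs]
  | cons s L ih =>
    have h1 : ∀ y, (wordDual θ L y).coeff (L.length + 1) = 0 := fun y =>
      coeff_eq_zero_of_natDegree_lt (Nat.lt_succ_of_le (natDegree_wordDual θ L y))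
    rw [wordDual_cons, List.length_cons, sub_mul, one_mul, coeff_neg, coeff_add, coeff_sub,
      coeff_X_mul, h1, h1, ih, rootMs, Module.End.mul_apply]
    ring

/-- The value at `t` of `dʲ D_{s₁}⁻ ⋯ D_{sₖ}⁻ f` for the Whittaker functional `f`. -/
noncomputable def wordVal (j : ℕ) (L : List RTree) (t : RTree) : ℂ[X] :=
  (-(X + C ((t.size : ℂ) - 1))) ^ j * wordDual θ L (e t)

theorem wordVal_eq (j : ℕ) (L : List RTree) (t : RTree) : wordVal θ j L t =
    (X + C ((t.size : ℂ) - 1)) ^ j * (C ((-1) ^ j) * wordDual θ L (e t)) := by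
  rw [wordVal, neg_pow, map_pow, map_neg, C_1]
  ring

theorem natDegree_wordVal (j : ℕ) (L : List RTree) (t : RTree) :
    (wordVal θ j L t).natDegree ≤ j + L.length := by
  rw [wordVal_eq]
  refine natDegree_mul_le.trans (add_le_add ?_ ?_)
  · refine natDegree_pow_le.trans ?_
    rw [natDegree_X_add_C, mul_one]
  · exact (natDegree_C_mul_le _ _).trans (natDegree_wordDual θ L _)

theorem coeff_wordVal (j : ℕ) (L : List RTree) (t : RTree) :
    (wordVal θ j L t).coeff (j + L.length) =
      (-1) ^ (j + L.length) * whit θ (rootMs L (e t)) := by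
  rw [wordVal_eq, coeff_mul_add_eq_of_natDegree_le (natDegree_pow_le_of_le j (natDegree_X_add_C _).le |>.trans (mul_one j).le)
    ((natDegree_C_mul_le _ _).trans (natDegree_wordDual θ L _)), coeff_C_mul, coeff_wordDual,
    coeff_X_add_C_pow, Nat.choose_self, Nat.sub_self]
  push_cast
  ring

theorem coeff_wordVal_nil (j : ℕ) (t : RTree) : (wordVal θ (j + 1) [] t).coeff j =
    (-1) ^ (j + 1) * (((t.size : ℂ) - 1) * (j + 1) * whit θ (e t)) := by
  rw [wordVal_eq, wordDual_nil, ← C_mul, coeff_mul_C, coeff_X_add_C_pow, Nat.choose_succ_self_right]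
  simp
  ring

end

end InsElim

namespace InsElim

open Polynomial

section
variable {θ : Tr →ₗ[ℂ] ℂ}

/-- A combination of the words `dʲ D_S⁻ f` that is proportional to `f`. -/
def Proportional (θ : Tr →ₗ[ℂ] ℂ) (c : Multiset RTree × ℕ →₀ ℂ) : Prop :=
  ∀ t, ∑ p ∈ c.support, C (c p) * (wordVal θ p.2 p.1.toList t -
    C (whit θ (e t)) * wordVal θ p.2 p.1.toList RTree.leaf) = 0

theorem rootMs_join_self (S : Multiset RTree) : whit θ (rootMs S.toList (e (RTree.join S))) ≠ 0 := by
  classical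
  have h1 := symFactor_ne_zero S
  have h2 := symFactor_ne_zero 0
  rw [rootMs_join, Multiset.coe_toList, if_pos le_rfl, tsub_self, map_smul, RTree.join_zero,
    whit_leaf, smul_eq_mul, mul_one]
  exact div_ne_zero (Nat.cast_ne_zero.2 h1) (Nat.cast_ne_zero.2 h2)

theorem rootMs_join_eq_zero {S T : Multiset RTree} (h : ¬ S ≤ T) :
    rootMs S.toList (e (RTree.join T)) = 0 := by
  classical
  rw [rootMs_join, Multiset.coe_toList, if_neg h]

theorem Proportional.eq_zero_of_degree_max {c : Multiset RTree × ℕ →₀ ℂ} (hc : Proportional θ c)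
    {K : ℕ} (hK : ∀ p ∈ c.support, p.2 + Multiset.card p.1 ≤ K) (p : Multiset RTree × ℕ)
    (hp : p.2 + Multiset.card p.1 = K) (hp0 : p.1 ≠ 0) : c p = 0 := by
  induction hn : Multiset.card p.1 using Nat.strong_induction_on generalizing p with
  | h n ih =>
  by_contra hne
  have h := congrArg (fun q => coeff q K) (hc (RTree.join p.1))
  simp only [finsetSum_coeff, coeff_zero, coeff_C_mul, coeff_sub] at h
  have hcoeff : ∀ q ∈ c.support, ∀ t, (wordVal θ q.2 q.1.toList t).coeff K =
      if q.2 + Multiset.card q.1 = K then (-1) ^ K * whit θ (rootMs q.1.toList (e t)) else 0 := by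
    intro q hq t
    split_ifs with hqK
    · have h1 := coeff_wordVal θ q.2 q.1.toList t
      rwa [Multiset.length_toList, hqK] at h1
    · refine coeff_eq_zero_of_natDegree_lt ((natDegree_wordVal θ _ _ _).trans_lt ?_)
      rw [Multiset.length_toList]
      exact lt_of_le_of_ne (hK q hq) hqK
  rw [Finset.sum_eq_single p] at h
  · have hps := Finsupp.mem_support_iff.2 hne
    have hL : p.1.toList ≠ [] := by rwa [Ne, Multiset.toList_eq_nil]
    rw [hcoeff p hps, hcoeff p hps, if_pos hp, if_pos hp, rootMs_leaf hL, map_zero, mul_zero,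
      mul_zero, sub_zero] at h
    rcases mul_eq_zero.1 h with h | h
    · exact hne h
    · rcases mul_eq_zero.1 h with h | h
      · exact pow_ne_zero _ (neg_ne_zero.2 one_ne_zero) h
      · exact rootMs_join_self _ h
  · intro q hq hqp
    rw [hcoeff q hq, hcoeff q hq]
    split_ifs with hqK
    · by_cases hq0 : q.1 = 0
      · rw [hq0, Multiset.toList_zero, rootMs, Module.End.one_apply, Module.End.one_apply, whit_leaf]
        ring
      · have hL : q.1.toList ≠ [] := by rwa [Ne, Multiset.toList_eq_nil]
        rw [rootMs_leaf hL, rootMs_join_eq_zero]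
        · simp
        · intro hle
          rcases (Multiset.card_le_card hle).lt_or_eq with hlt | heq
          · exact Finsupp.mem_support_iff.1 hq (ih _ (hn ▸ hlt) q hqK hq0 rfl)
          · have h1 := Multiset.eq_of_le_of_card_le hle heq.ge
            exact hqp (Prod.ext h1 (by omega))
    · simp
  · intro h'; exact absurd (Finsupp.mem_support_iff.2 hne) h'

theorem Proportional.exists_singleton_mem {c : Multiset RTree × ℕ →₀ ℂ} (hc : Proportional θ c)
    (hθ : ∀ s t, θ (ins s t) = θ (ins t s)) {K : ℕ}
    (hK : ∀ p ∈ c.support, p.2 + Multiset.card p.1 ≤ K + 1) {p : Multiset RTree × ℕ}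
    (hp : p ∈ c.support) (hpK : p.2 + Multiset.card p.1 = K + 1) {s : RTree} (hs : θ (e s) ≠ 0) :
    ∃ j, ({s}, j) ∈ c.support := by
  by_contra! hno
  have hmax : ∀ q ∈ c.support, q.2 + Multiset.card q.1 = K + 1 → q = (0, K + 1) := by
    intro q hq hqK
    have hq0 : q.1 = 0 := by
      by_contra hq0
      exact Finsupp.mem_support_iff.1 hq (hc.eq_zero_of_degree_max hK q hqK hq0)
    rw [hq0, Multiset.card_zero, add_zero] at hqK
    exact Prod.ext hq0 hqK
  obtain rfl := hmax p hp hpK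
  have h := congrArg (fun q => coeff q K) (hc (RTree.join {s}))
  simp only [finsetSum_coeff, coeff_zero, coeff_C_mul, coeff_sub] at h
  have hf : whit θ (e (RTree.join {s})) = θ (e s) := by
    rw [← whit_gr_leaf hθ, gr_single]; rfl
  rw [Finset.sum_eq_single (0, K + 1)] at h
  · simp only [Multiset.toList_zero, coeff_wordVal_nil, hf, RTree.size_leaf, whit_leaf,
      RTree.size_join] at h
    have h1 : c (0, K + 1) * ((-1) ^ (K + 1) * (s.size * (K + 1) * θ (e s))) = 0 := by
      rw [← h]
      simp
    have h2 : ((K : ℂ) + 1) ≠ 0 := Nat.cast_add_one_ne_zero K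
    have h3 : (s.size : ℂ) ≠ 0 := Nat.cast_ne_zero.2 s.size_pos.ne'
    have h4 : ((-1 : ℂ)) ^ (K + 1) ≠ 0 := pow_ne_zero _ (neg_ne_zero.2 one_ne_zero)
    have h5 := Finsupp.mem_support_iff.1 hp
    simp_all
  · intro q hq hqp
    have hqK : q.2 + Multiset.card q.1 ≤ K := by
      have h1 : q.2 + Multiset.card q.1 ≠ K + 1 := fun h => hqp (hmax q hq h)
      have := hK q hq
      omega
    rcases hqK.lt_or_eq with hlt | heq
    · have h0 : ∀ t, (wordVal θ q.2 q.1.toList t).coeff K = 0 := fun t => by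
        refine coeff_eq_zero_of_natDegree_lt ((natDegree_wordVal θ _ _ _).trans_lt ?_)
        rwa [Multiset.length_toList]
      rw [h0, h0]
      ring
    · have h1 : ∀ t, (wordVal θ q.2 q.1.toList t).coeff K =
          (-1) ^ K * whit θ (rootMs q.1.toList (e t)) := fun t => by
        have h1 := coeff_wordVal θ q.2 q.1.toList t
        rwa [Multiset.length_toList, heq] at h1
      rw [h1, h1]
      by_cases hq0 : q.1 = 0
      · rw [hq0, Multiset.toList_zero, rootMs, Module.End.one_apply, Module.End.one_apply, whit_leaf]
        ring
      · have hL : q.1.toList ≠ [] := by rwa [Ne, Multiset.toList_eq_nil]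
        rw [rootMs_leaf hL, rootMs_join_eq_zero]
        · simp
        · intro hle
          rw [Multiset.le_singleton] at hle
          rcases hle with h | h
          · exact hq0 h
          · refine hno q.2 ?_
            rw [← h]
            exact hq
  · intro h'; exact absurd hp h'

end

section
variable {θ : Tr →ₗ[ℂ] ℂ}

theorem opM_gr_leaf (s : RTree) (x : Tr) : opM s (gr (e RTree.leaf) x) =
    gr (e RTree.leaf) (opM s x) + x s • e RTree.leaf := by
  rw [qder_opM s, opM_e, elim_leaf, map_zero, LinearMap.zero_apply, zero_add]
  rfl

theorem rootM_gr_leaf (s : RTree) (x : Tr) : rootM s (gr (e RTree.leaf) x) =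
    x s • e RTree.leaf := by
  rw [rootM_gr, rootM_leaf, map_zero, LinearMap.zero_apply, zero_add]

theorem wordDual_gr_leaf (hθ : ∀ s t, θ (ins s t) = θ (ins t s)) (L : List RTree) {N : ℕ}
    (hN : 0 < N) {x : Tr} (hx : x ∈ treesWith fun t => t.size = listSize L + N) :
    wordDual θ L (gr (e RTree.leaf) x) = C ((-1) ^ L.length * θ (opMs L x)) := by
  induction L generalizing x with
  | nil => simp [wordDual_nil, whit_gr_leaf hθ, opMs]
  | cons s L ih =>
    have hxs : x s = 0 := by
      by_contra h
      have h1 : s.size = listSize (s :: L) + N :=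
        ((Finsupp.mem_supported ℂ x).1 hx) (Finsupp.mem_support_iff.2 h)
      rw [listSize_cons] at h1
      omega
    simp only [listSize_cons, add_assoc] at hx
    rw [wordDual_cons, opM_gr_leaf, rootM_gr_leaf, hxs, zero_smul, add_zero, map_zero, mul_zero,
      add_zero, ih (opM_mem_size s hx), ← C_neg, opMs, Module.End.mul_apply, List.length_cons,
      pow_succ]
    congr 1
    ring

theorem rootM_mem_size (s : RTree) {n : ℕ} {x : Tr}
    (hx : x ∈ treesWith fun t => t.size = s.size + n) : rootM s x ∈ treesWith fun t => t.size = n := by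
  classical
  refine map_mem_of_treesWith (fun t ht => ?_) hx
  rw [rootM_e]
  by_cases h : s ∈ t.branches
  · refine Submodule.smul_mem _ _ (e_mem_treesWith ?_)
    have h1 := RTree.size_join t.branches
    rw [← Multiset.cons_erase h, Multiset.map_cons, Multiset.sum_cons, Multiset.cons_erase h,
      RTree.join_branches] at h1
    rw [RTree.size_join]
    omega
  · simp [Multiset.count_eq_zero_of_notMem h]

theorem treesWith_inf (P Q : RTree → Prop) :
    treesWith (fun t => P t ∧ Q t) = treesWith P ⊓ treesWith Q :=
  Finsupp.supported_inter _ _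

theorem rootM_mem (s : RTree) {n ρ : ℕ} {x : Tr}
    (hx : x ∈ treesWith fun t => t.size = s.size + n ∧ ρ + 1 ≤ t.rdeg) :
    rootM s x ∈ treesWith fun t => t.size = n ∧ ρ ≤ t.rdeg := by
  refine map_mem_of_treesWith (fun t ht => ?_) hx
  rw [treesWith_inf]
  refine ⟨rootM_mem_size s (e_mem_treesWith ht.1), ?_⟩
  obtain ⟨k, hk⟩ := Nat.exists_eq_add_of_le ht.2
  refine treesWith_mono ?_ (rootM_mem_rdeg s (n := ρ + k) (e_mem_treesWith (by omega)))
  intro t ht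
  omega

theorem innerM_mem (s : RTree) {n ρ : ℕ} {x : Tr}
    (hx : x ∈ treesWith fun t => t.size = s.size + n ∧ ρ ≤ t.rdeg) :
    innerM s x ∈ treesWith fun t => t.size = n ∧ ρ ≤ t.rdeg := by
  refine map_mem_of_treesWith (fun t ht => ?_) hx
  rw [treesWith_inf]
  refine ⟨Submodule.sub_mem _ (opM_mem_size s (e_mem_treesWith ht.1))
    (rootM_mem_size s (e_mem_treesWith ht.1)), ?_⟩
  refine treesWith_mono ?_ (innerM_mem_rdeg s (n := t.rdeg) (e_mem_treesWith rfl))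
  intro r hr
  rw [hr]
  exact ht.2

theorem opM_eq (s : RTree) (x : Tr) : opM s x = rootM s x + innerM s x := by
  rw [innerM_apply]; abel

theorem opM_mem (s : RTree) {n ρ : ℕ} {x : Tr}
    (hx : x ∈ treesWith fun t => t.size = s.size + n ∧ ρ + 1 ≤ t.rdeg) :
    opM s x ∈ treesWith fun t => t.size = n ∧ ρ ≤ t.rdeg := by
  rw [opM_eq]
  exact Submodule.add_mem _ (rootM_mem s hx) (innerM_mem s (treesWith_mono (fun t ht =>
    ⟨ht.1, (Nat.le_succ _).trans ht.2⟩) hx))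

theorem opMs_mem (L : List RTree) {n ρ : ℕ} {x : Tr}
    (hx : x ∈ treesWith fun t => t.size = listSize L + n ∧ ρ + L.length ≤ t.rdeg) :
    opMs L x ∈ treesWith fun t => t.size = n ∧ ρ ≤ t.rdeg := by
  induction L generalizing x with
  | nil =>
    refine treesWith_mono (fun t ht => ?_) hx
    simpa [listSize] using ht
  | cons s L ih =>
    simp only [listSize_cons, add_assoc, List.length_cons] at hx
    exact ih (opM_mem s hx)

theorem map_opMs_eq_map_rootMs {φ : Tr →ₗ[ℂ] ℂ} (L : List RTree) {n ρ : ℕ} {x : Tr}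
    (hφ : ∀ x ∈ treesWith fun t => t.size = n ∧ ρ + 1 ≤ t.rdeg, φ x = 0)
    (hx : x ∈ treesWith fun t => t.size = listSize L + n ∧ ρ + L.length ≤ t.rdeg) :
    φ (opMs L x) = φ (rootMs L x) := by
  induction L generalizing x with
  | nil => rfl
  | cons s L ih =>
    simp only [listSize_cons, add_assoc, List.length_cons] at hx
    rw [opMs, rootMs, Module.End.mul_apply, Module.End.mul_apply, opM_eq, map_add, map_add,
      ih (rootM_mem s hx), hφ (opMs L (innerM s x)), add_zero]
    refine opMs_mem L (treesWith_mono (fun t ht => ⟨ht.1, ?_⟩) (innerM_mem s hx))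
    omega

end

end InsElim

namespace InsElim

open Polynomial

section
variable {θ : Tr →ₗ[ℂ] ℂ}

open Classical in
/-- The restriction of a functional to the trees with `ω` vertices and root degree `m`. -/
noncomputable def cutoff (θ : Tr →ₗ[ℂ] ℂ) (ω m : ℕ) : Tr →ₗ[ℂ] ℂ :=
  Finsupp.lsum ℂ fun t => LinearMap.toSpanSingleton ℂ _
    (if t.size = ω ∧ t.rdeg = m then θ (e t) else 0)

open Classical in
theorem cutoff_e (θ : Tr →ₗ[ℂ] ℂ) (ω m : ℕ) (t : RTree) :
    cutoff θ ω m (e t) = if t.size = ω ∧ t.rdeg = m then θ (e t) else 0 := by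
  simp [cutoff, e]

theorem toFinsupp_le_iff [DecidableEq RTree] {S T : Multiset RTree} :
    Multiset.toFinsupp S ≤ Multiset.toFinsupp T ↔ S ≤ T := by
  rw [Multiset.le_iff_count, Finsupp.le_def]
  simp

theorem toFinsupp_sub [DecidableEq RTree] (S T : Multiset RTree) :
    Multiset.toFinsupp T - Multiset.toFinsupp S = Multiset.toFinsupp (T - S) := by
  ext a
  simp

/-- For a nonzero functional that is supported on finitely many trees, the convolution with a
nonzero combination of multisets of branches is nonzero. -/
theorem exists_sum_rootMs_ne_zero {φ : Tr →ₗ[ℂ] ℂ} (hfin : {t | φ (e t) ≠ 0}.Finite)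
    {r : RTree} (hr : φ (e r) ≠ 0) {c : Multiset RTree →₀ ℂ} (hc : c ≠ 0) :
    ∃ C : Multiset RTree, ∑ S ∈ c.support, c S * φ (rootMs S.toList (e (RTree.join C))) ≠ 0 := by
  classical
  let P : MvPolynomial RTree ℂ := ∑ S ∈ c.support, MvPolynomial.monomial (Multiset.toFinsupp S) (c S)
  let Q : MvPolynomial RTree ℂ := ∑ t ∈ hfin.toFinset,
    MvPolynomial.monomial (Multiset.toFinsupp t.branches) (φ (e t) / symFactor t.branches)
  have hP : ∀ T, P.coeff (Multiset.toFinsupp T) = c T := by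
    intro T
    simp only [P, MvPolynomial.coeff_sum, MvPolynomial.coeff_monomial,
      (Multiset.toFinsupp (α := RTree)).injective.eq_iff, Finset.sum_ite_eq', ite_eq_left_iff]
    exact fun h => (Finsupp.notMem_support_iff.1 h).symm
  have hQ : ∀ T, Q.coeff (Multiset.toFinsupp T) = φ (e (RTree.join T)) / symFactor T := by
    intro T
    simp only [Q, MvPolynomial.coeff_sum, MvPolynomial.coeff_monomial,
      (Multiset.toFinsupp (α := RTree)).injective.eq_iff]
    rw [Finset.sum_eq_single (RTree.join T)]
    · rw [RTree.branches_join, if_pos rfl]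
    · intro t _ ht
      rw [if_neg]
      rintro rfl
      exact ht (RTree.join_branches t).symm
    · intro h
      have h1 : φ (e (RTree.join T)) = 0 := by simpa using h
      simp [h1]
  have hP0 : P ≠ 0 := by
    intro h
    refine hc (Finsupp.ext fun T => ?_)
    rw [← hP, h]
    rfl
  have hQ0 : Q ≠ 0 := by
    intro h
    have h1 := hQ r.branches
    rw [h, RTree.join_branches, MvPolynomial.coeff_zero, eq_comm, div_eq_zero_iff] at h1
    rcases h1 with h1 | h1
    · exact hr h1
    · exact symFactor_ne_zero _ (Nat.cast_eq_zero.1 h1)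
  obtain ⟨M, hM⟩ := MvPolynomial.ne_zero_iff.1 (mul_ne_zero hP0 hQ0)
  obtain ⟨C, rfl⟩ := Multiset.toFinsupp.surjective M
  refine ⟨C, ?_⟩
  have hC : (symFactor C : ℂ) ≠ 0 := Nat.cast_ne_zero.2 (symFactor_ne_zero C)
  have h : ∑ S ∈ c.support, c S * φ (rootMs S.toList (e (RTree.join C))) =
      symFactor C * (P * Q).coeff (Multiset.toFinsupp C) := by
    simp only [P, Finset.sum_mul, MvPolynomial.coeff_sum, Finset.mul_sum,
      MvPolynomial.coeff_monomial_mul', toFinsupp_le_iff, toFinsupp_sub, hQ]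
    refine Finset.sum_congr rfl fun S _ => ?_
    rw [rootMs_join, Multiset.coe_toList]
    split_ifs
    · rw [map_smul, smul_eq_mul]; ring
    · simp
  rw [h]
  exact mul_ne_zero hC hM

theorem sum_X_add_C_pow_eq_zero {ι : Type*} {s : Finset ι} {a : ι → ℂ} {j : ι → ℕ} {q : ℂ}
    (h : ∑ i ∈ s, C (a i) * (-(X + C q)) ^ j i = 0) (k : ℕ) :
    ∑ i ∈ s with j i = k, a i = 0 := by
  have h1 : (∑ i ∈ s, C (a i) * X ^ j i : ℂ[X]) = 0 := by
    have h2 := congrArg (fun p => p.comp (-X - C q)) h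
    simp only [Polynomial.sum_comp, mul_comp, C_comp, pow_comp, neg_comp, add_comp, X_comp,
      zero_comp] at h2
    rw [← h2]
    refine Finset.sum_congr rfl fun i _ => ?_
    congr 2
    ring
  have h2 := congrArg (fun p => coeff p k) h1
  simp only [finsetSum_coeff, coeff_C_mul, coeff_X_pow, coeff_zero, mul_ite, mul_one, mul_zero] at h2
  rw [Finset.sum_filter]
  refine (Finset.sum_congr rfl fun i _ => ?_).trans h2
  simp only [eq_comm]

theorem opMs_mem_size (L : List RTree) {n : ℕ} {x : Tr}
    (hx : x ∈ treesWith fun t => t.size = listSize L + n) :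
    opMs L x ∈ treesWith fun t => t.size = n := by
  induction L generalizing x with
  | nil => simpa [listSize, opMs] using hx
  | cons s L ih =>
    simp only [listSize_cons, add_assoc] at hx
    exact ih (opM_mem_size s hx)

theorem listSize_toList (S : Multiset RTree) : listSize S.toList = (S.map RTree.size).sum := by
  rw [listSize, ← Multiset.sum_coe, ← Multiset.map_coe, Multiset.coe_toList]

theorem Proportional.eq_zero_of_finite {c : Multiset RTree × ℕ →₀ ℂ} (hc : Proportional θ c)
    (hθ : ∀ s t, θ (ins s t) = θ (ins t s)) (hfin : {t | θ (e t) ≠ 0}.Finite)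
    {r : RTree} (hr : θ (e r) ≠ 0) {p : Multiset RTree × ℕ} (hp : p ∈ c.support) : p.1 = 0 := by
  classical
  by_contra hp0
  -- the extremal trees in the support of `θ`
  obtain ⟨r₀, hr₀, hω⟩ := hfin.toFinset.exists_max_image RTree.size ⟨r, by simpa using hr⟩
  set ω := r₀.size with hω_def
  obtain ⟨r₁, hr₁, hm⟩ := (hfin.toFinset.filter fun t => t.size = ω).exists_max_image RTree.rdeg
    ⟨r₀, Finset.mem_filter.2 ⟨hr₀, rfl⟩⟩
  set m := r₁.rdeg with hm_def
  have hr₁' : θ (e r₁) ≠ 0 ∧ r₁.size = ω := by simpa using hr₁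
  have hsize : ∀ t, ω < t.size → θ (e t) = 0 := by
    intro t ht
    by_contra h
    have := hω t (by simpa using h)
    omega
  have hdeg : ∀ t, t.size = ω → m < t.rdeg → θ (e t) = 0 := by
    intro t ht ht'
    by_contra h
    have := hm t (by simp [h, ht])
    omega
  -- the extremal words
  let wt : Multiset RTree × ℕ → ℕ := fun q => listSize q.1.toList
  obtain ⟨p₀, hp₀, hn⟩ := c.support.exists_max_image wt ⟨p, hp⟩
  set n := wt p₀ with hn_def
  obtain ⟨p₁, hp₁, hk⟩ := (c.support.filter fun q => wt q = n).exists_max_image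
    (fun q => Multiset.card q.1) ⟨p₀, Finset.mem_filter.2 ⟨hp₀, rfl⟩⟩
  set k := Multiset.card p₁.1 with hk_def
  have hp₁' : p₁ ∈ c.support ∧ wt p₁ = n := Finset.mem_filter.1 hp₁
  have hn0 : 0 < n := by
    refine lt_of_lt_of_le ?_ (hn p hp)
    obtain ⟨s, hs⟩ := Multiset.exists_mem_of_ne_zero hp0
    obtain ⟨D, hD⟩ := Multiset.exists_cons_of_mem hs
    change 0 < listSize p.1.toList
    rw [listSize_toList, hD, Multiset.map_cons, Multiset.sum_cons]
    have := s.size_pos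
    omega
  have hω0 : 0 < ω := RTree.size_pos _
  let B := c.support.filter fun q => wt q = n ∧ Multiset.card q.1 = k
  have hB : ∀ q, q ∈ B ↔ q ∈ c.support ∧ wt q = n ∧ Multiset.card q.1 = k := fun q =>
    Finset.mem_filter
  have key : ∀ t : RTree, t.size = n + ω → t.rdeg = m + k →
      ∑ q ∈ B with q.2 = p₁.2, c q * θ (rootMs q.1.toList (e t)) = 0 := by
    intro t ht htd
    have h := hc (RTree.join {t})
    have hj : e (RTree.join {t}) = gr (e RTree.leaf) (e t) := by rw [gr_single]; rfl
    have h0 : whit θ (e (RTree.join {t})) = 0 := by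
      rw [hj, whit_gr_leaf hθ]
      exact hsize t (by omega)
    have h1 : ∀ q ∈ c.support, wordVal θ q.2 q.1.toList (RTree.join {t}) =
        if q ∈ B then (-(X + C (t.size : ℂ))) ^ q.2 *
          C ((-1) ^ k * θ (rootMs q.1.toList (e t))) else 0 := by
      intro q hq
      have hqn : wt q ≤ n := hn q hq
      obtain ⟨N, hN⟩ := Nat.exists_eq_add_of_le hqn
      have hsz : t.size = listSize q.1.toList + (N + ω) := by
        change n = listSize q.1.toList + N at hN
        omega
      have h2 : wordVal θ q.2 q.1.toList (RTree.join {t}) = (-(X + C (t.size : ℂ))) ^ q.2 *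
          C ((-1) ^ Multiset.card q.1 * θ (opMs q.1.toList (e t))) := by
        rw [wordVal, hj, wordDual_gr_leaf hθ _ (N := N + ω) (by omega) (e_mem_treesWith hsz),
          RTree.size_join, Multiset.length_toList]
        simp
      rw [h2]
      have hzero : ∀ ω' m', (∀ t, t.size = ω' → m' ≤ t.rdeg → θ (e t) = 0) →
          ∀ x ∈ treesWith fun t => t.size = ω' ∧ m' ≤ t.rdeg, θ x = 0 := by
        intro ω' m' h x hx
        exact (Submodule.mem_bot ℂ).1 (map_mem_of_treesWith
          (fun t ht => (Submodule.mem_bot ℂ).2 (h t ht.1 ht.2)) hx)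
      by_cases hqw : wt q = n
      · have hN0 : N = 0 := by omega
        subst hN0
        rw [zero_add] at hsz
        have hqk : Multiset.card q.1 ≤ k := hk q (Finset.mem_filter.2 ⟨hq, hqw⟩)
        by_cases hqk' : Multiset.card q.1 = k
        · rw [if_pos ((hB q).2 ⟨hq, hqw, hqk'⟩), hqk', map_opMs_eq_map_rootMs _ (n := ω) (ρ := m)]
          · exact hzero _ _ fun t ht ht' => hdeg t ht (by omega)
          · exact e_mem_treesWith ⟨hsz, by rw [Multiset.length_toList]; omega⟩
        · rw [if_neg fun h => hqk' ((hB q).1 h).2.2,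
            hzero ω (m + 1) (fun t ht ht' => hdeg t ht (by omega))]
          · simp
          · exact opMs_mem _ (e_mem_treesWith ⟨hsz, by rw [Multiset.length_toList]; omega⟩)
      · rw [if_neg fun h => hqw ((hB q).1 h).2.1,
          hzero (N + ω) 0 (fun t ht _ => hsize t (by omega))]
        · simp
        · exact treesWith_mono (fun r hr => ⟨hr, Nat.zero_le _⟩) (opMs_mem_size _ (e_mem_treesWith hsz))
    rw [h0] at h
    have h5 : ∑ q ∈ B, C (c q * ((-1) ^ k * θ (rootMs q.1.toList (e t)))) *
        (-(X + C (t.size : ℂ))) ^ q.2 = 0 := by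
      rw [← h, ← Finset.sum_subset (Finset.filter_subset _ _ : B ⊆ c.support)]
      · refine Finset.sum_congr rfl fun q hq => ?_
        rw [h1 q ((hB q).1 hq).1, if_pos hq, C_mul, C_0]
        ring
      · intro q hq hqB
        rw [h1 q hq, if_neg hqB, C_0]
        ring
    have h6 := sum_X_add_C_pow_eq_zero h5 p₁.2
    have h7 : ((-1 : ℂ)) ^ k ≠ 0 := pow_ne_zero _ (neg_ne_zero.2 one_ne_zero)
    refine (mul_eq_zero.1 (?_ : (-1 : ℂ) ^ k * _ = 0)).resolve_left h7
    rw [← h6, Finset.mul_sum]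
    refine Finset.sum_congr rfl fun q _ => ?_
    ring
  -- the combination of the extremal words
  let c' : Multiset RTree →₀ ℂ := Finsupp.onFinset (B.image Prod.fst)
    (fun S => if (S, p₁.2) ∈ B then c (S, p₁.2) else 0) (by
      intro S hS
      have hS' : (S, p₁.2) ∈ B := by by_contra h; simp [h] at hS
      exact Finset.mem_image_of_mem _ hS')
  have hp₁B : p₁ ∈ B := (hB p₁).2 ⟨hp₁'.1, hp₁'.2, rfl⟩
  have hc'_apply : ∀ S, c' S = if (S, p₁.2) ∈ B then c (S, p₁.2) else 0 := fun S => rfl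
  have hc' : c' ≠ 0 := by
    intro h
    have h1 := hc'_apply p₁.1
    rw [h, if_pos hp₁B] at h1
    exact Finsupp.mem_support_iff.1 hp₁'.1 h1.symm
  have hfin' : {t | cutoff θ ω m (e t) ≠ 0}.Finite := by
    refine hfin.subset fun t ht => ?_
    intro h
    refine ht ?_
    rw [cutoff_e, h, ite_self]
  have hr₁'' : cutoff θ ω m (e r₁) ≠ 0 := by
    rw [cutoff_e, if_pos ⟨hr₁'.2, rfl⟩]
    exact hr₁'.1
  obtain ⟨T, hT⟩ := exists_sum_rootMs_ne_zero hfin' hr₁'' hc'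
  have hmemB : ∀ S, S ∈ c'.support → (S, p₁.2) ∈ B := by
    intro S hS
    by_contra h
    rw [Finsupp.mem_support_iff, hc'_apply, if_neg h] at hS
    exact hS rfl
  have hval : ∀ S, (S, p₁.2) ∈ B → S ≤ T →
      (RTree.join T).size = n + (RTree.join (T - S)).size ∧
      (RTree.join T).rdeg = (RTree.join (T - S)).rdeg + k := by
    intro S hS hle
    obtain ⟨-, h1, h2⟩ := (hB _).1 hS
    obtain ⟨D, rfl⟩ := Multiset.le_iff_exists_add.1 hle
    rw [add_tsub_cancel_left]
    have h3 : (S.map RTree.size).sum = n := by rw [← listSize_toList]; exact h1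
    have h4 : Multiset.card S = k := h2
    simp only [RTree.size_join, RTree.rdeg_join, Multiset.map_add, Multiset.sum_add,
      Multiset.card_add, h3, h4]
    omega
  obtain ⟨S, hS, hSne⟩ := Finset.exists_ne_zero_of_sum_ne_zero hT
  have hSne' := right_ne_zero_of_mul hSne
  have hle : S ≤ T := by
    by_contra h
    rw [rootMs_join_eq_zero h, map_zero] at hSne'
    exact hSne' rfl
  rw [rootMs_join, Multiset.coe_toList, if_pos hle, map_smul, cutoff_e] at hSne'
  have hcond : (RTree.join (T - S)).size = ω ∧ (RTree.join (T - S)).rdeg = m := by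
    by_contra h
    rw [if_neg h, smul_zero] at hSne'
    exact hSne' rfl
  have hT1 := hval S (hmemB S hS) hle
  rw [hcond.1, hcond.2] at hT1
  refine hT ?_
  rw [← key _ hT1.1 hT1.2]
  refine Finset.sum_bij (fun S _ => (S, p₁.2)) ?_ ?_ ?_ ?_
  · intro S hS
    exact Finset.mem_filter.2 ⟨hmemB S hS, rfl⟩
  · intro S _ S' _ h
    exact congrArg Prod.fst h
  · rintro ⟨S, j⟩ hq
    obtain ⟨hq, rfl⟩ := Finset.mem_filter.1 hq
    refine ⟨S, ?_, rfl⟩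
    rw [Finsupp.mem_support_iff, hc'_apply, if_pos hq]
    exact Finsupp.mem_support_iff.1 ((hB _).1 hq).1
  · intro S hS
    have hSB := hmemB S hS
    rw [hc'_apply, if_pos hSB]
    congr 1
    by_cases hle : S ≤ T
    · have h := hval S hSB hle
      rw [rootMs_join, Multiset.coe_toList, if_pos hle, map_smul, map_smul, cutoff_e, if_pos]
      omega
    · rw [rootMs_join_eq_zero hle, map_zero, map_zero]

theorem Proportional.eq_zero {c : Multiset RTree × ℕ →₀ ℂ} (hc : Proportional θ c)
    (hθ : ∀ s t, θ (ins s t) = θ (ins t s)) {r : RTree} (hr : θ (e r) ≠ 0)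
    {p : Multiset RTree × ℕ} (hp : p ∈ c.support) : p = (0, 0) := by
  classical
  obtain ⟨p₀, hp₀, hmax⟩ := c.support.exists_max_image (fun q => q.2 + Multiset.card q.1) ⟨p, hp⟩
  obtain hK | ⟨K, hK⟩ : p₀.2 + Multiset.card p₀.1 = 0 ∨ ∃ K, p₀.2 + Multiset.card p₀.1 = K + 1 := by
    rcases h : p₀.2 + Multiset.card p₀.1 with _ | K
    · exact Or.inl rfl
    · exact Or.inr ⟨K, rfl⟩
  · have h := hmax p hp
    exact Prod.ext (Multiset.card_eq_zero.1 (by omega)) (by dsimp only; omega)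
  · have hex : ∀ s, θ (e s) ≠ 0 → ∃ j, (({s} : Multiset RTree), j) ∈ c.support := fun s hs =>
      hc.exists_singleton_mem hθ (fun q hq => hK ▸ hmax q hq) hp₀ hK hs
    have hfin : {t | θ (e t) ≠ 0}.Finite := by
      refine Set.Finite.of_finite_image (f := fun t => ({t} : Multiset RTree))
        ((c.support.image Prod.fst).finite_toSet.subset ?_)
        (fun a _ b _ h => Multiset.singleton_inj.1 h)
      rintro _ ⟨t, ht, rfl⟩
      obtain ⟨j, hj⟩ := hex t ht
      exact Finset.mem_image_of_mem Prod.fst hj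
    obtain ⟨j, hj⟩ := hex r hr
    exact absurd (hc.eq_zero_of_finite hθ hfin hr hj) (Multiset.singleton_ne_zero r)

end

end InsElim

namespace InsElim

open Polynomial

section
variable (η : nPlus →ₗ⁅ℂ⁆ ℂ)

theorem toDual_lieOp (x : Alg) (w : Whittaker η) :
    toDual η (lieOp η x w) = coAct x (toDual η w) := by
  rw [lieOp_apply, toDual_smul, coRep_ι]

theorem toDual_word (j : ℕ) (L : List RTree) : toDual η (word η j L) =
    ((coAct dd : Module.End ℂ PolyDual) ^ j) (wordDual (weight η) L) := by
  induction j with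
  | zero =>
    induction L with
    | nil => exact toDual_gen η
    | cons s L ih => exact (toDual_lieOp η _ _).trans (congrArg (coAct (Dm s)) ih)
  | succ j ih => rw [word_succ, toDual_lieOp, ih, pow_succ', Module.End.mul_apply]

theorem toDual_word_e (j : ℕ) (L : List RTree) (t : RTree) :
    toDual η (word η j L) (e t) = wordVal (weight η) j L t := by
  rw [toDual_word, coAct_dd_pow, wordVal]

variable {η}

theorem exists_ne_zero (hη : η ≠ 0) : ∃ t, weight η (e t) ≠ 0 := by
  by_contra! h
  have h0 : weight η = 0 := Tr.hom_ext h
  refine hη (LieHom.ext fun x => ?_)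
  obtain ⟨y, rfl⟩ := exists_nPlusL_eq x
  have h1 : weight η y = 0 := by rw [h0]; rfl
  rw [weight_apply, neg_eq_zero] at h1
  exact h1

theorem toDual_eq_of_forall_Dp {w : Whittaker η}
    (hw : ∀ t, lieOp η (Dp t) w = η (nPlusD t) • w) (x : Tr) :
    toDual η w x = C (whit (weight η) x) * toDual η w (e RTree.leaf) := by
  have h : toDual η w - LinearMap.mulRight ℂ (toDual η w (e RTree.leaf)) ∘ₗ whitDual η = 0 := by
    refine eq_zero_of_opP (θ := weight η) ?_ fun t x => ?_
    · simp [whitDual_apply, whit_leaf]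
    · have h1 := congrArg (fun φ : PolyDual => φ x) (congrArg (toDual η) (hw t))
      rw [toDual_lieOp, coAct_apply, act_Dp, defAct_Dp, LinearMap.zero_apply, map_zero, mul_zero,
        add_zero, map_smul, LinearMap.smul_apply, neg_eq_iff_eq_neg, ← neg_smul, ← weight_e] at h1
      simp only [LinearMap.sub_apply, LinearMap.comp_apply, LinearMap.mulRight_apply, h1,
        whitDual_apply, whit_opP (weight_ins η), smul_sub, Polynomial.smul_eq_C_mul, C_mul, mul_assoc]
  exact sub_eq_zero.1 (congrArg (fun φ : PolyDual => φ x) h)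

theorem mem_span_gen_of_forall_Dp (hη : η ≠ 0) {w : Whittaker η}
    (hw : ∀ t, lieOp η (Dp t) w = η (nPlusD t) • w) : ∃ a : ℂ, w = a • gen η := by
  classical
  obtain ⟨r, hr⟩ := exists_ne_zero hη
  obtain ⟨c, rfl⟩ := exists_finsupp_eq η w
  have hval : ∀ t, toDual η (c.sum fun p a => a • word η p.2 p.1.toList) (e t) =
      ∑ p ∈ c.support, C (c p) * wordVal (weight η) p.2 p.1.toList t := by
    intro t
    rw [Finsupp.sum, map_sum, LinearMap.sum_apply]
    refine Finset.sum_congr rfl fun p _ => ?_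
    rw [map_smul, LinearMap.smul_apply, toDual_word_e, Polynomial.smul_eq_C_mul]
  have hc : Proportional (weight η) c := by
    intro t
    have h := toDual_eq_of_forall_Dp hw (e t)
    rw [hval, hval, Finset.mul_sum, ← sub_eq_zero, ← Finset.sum_sub_distrib] at h
    rw [← h]
    refine Finset.sum_congr rfl fun p _ => ?_
    ring
  refine ⟨c (0, 0), ?_⟩
  rw [Finsupp.sum, Finset.sum_eq_single (0, 0)]
  · rw [Multiset.toList_zero]; rfl
  · intro p hp hp0
    exact absurd (hc.eq_zero (weight_ins η) hr hp) hp0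
  · intro h
    rw [Finsupp.notMem_support_iff.1 h, zero_smul]

theorem gen_mem_of_lexSpan_succ (hη : η ≠ 0) {N : Submodule Ug (Whittaker η)} {n J : ℕ}
    (ih : ∀ w ∈ N, w ≠ 0 → w ∈ lexSpan η n J → gen η ∈ N) {w : Whittaker η} (hw : w ∈ N)
    (hw0 : w ≠ 0) (hJ : w ∈ lexSpan η n (J + 1)) : gen η ∈ N := by
  have hsmul : ∀ (a : ℂ), ∀ v ∈ N, a • v ∈ N := fun a v hv => by
    rw [← algebraMap_smul Ug]
    exact N.smul_mem _ hv
  by_cases h : ∀ t, lieOp η (Dp t) w = η (nPlusD t) • w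
  · obtain ⟨a, rfl⟩ := mem_span_gen_of_forall_Dp hη h
    have ha : a ≠ 0 := by rintro rfl; exact hw0 (zero_smul _ _)
    have h1 := hsmul a⁻¹ _ hw
    rwa [smul_smul, inv_mul_cancel₀ ha, one_smul] at h1
  · push Not at h
    obtain ⟨t, ht⟩ := h
    exact ih _ (N.sub_mem (N.smul_mem _ hw) (hsmul _ _ hw)) (sub_ne_zero.2 ht)
      (Dp_sub_mem_lexSpan η t hJ)

theorem gen_mem_of_mem_lexSpan (hη : η ≠ 0) (N : Submodule Ug (Whittaker η)) (n J : ℕ) :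
    ∀ w ∈ N, w ≠ 0 → w ∈ lexSpan η n J → gen η ∈ N := by
  induction n generalizing J with
  | zero =>
    induction J with
    | zero =>
      intro w _ hw0 hJ
      refine absurd ?_ hw0
      have h : {w | ∃ j L, (listSize L < 0 ∨ listSize L = 0 ∧ j < 0) ∧ w = word η j L} = ∅ := by
        ext w; simp
      rwa [lexSpan, h, Submodule.span_empty, Submodule.mem_bot] at hJ
    | succ J ih => exact fun w hw hw0 hJ => gen_mem_of_lexSpan_succ hη ih hw hw0 hJ
  | succ n ihn =>
    induction J with
    | zero =>
      intro w hw hw0 hJ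
      obtain ⟨J, hJ'⟩ := exists_mem_lexSpan_of_succ η hJ
      exact ihn J w hw hw0 hJ'
    | succ J ih => exact fun w hw hw0 hJ => gen_mem_of_lexSpan_succ hη ih hw hw0 hJ

/-- Root-boundedness of `η` is not needed. -/
theorem finrank_whittakerVectors (hη : η ≠ 0) : Module.finrank ℂ (whittakerVectors η) = 1 := by
  refine finrank_eq_one (⟨gen η, nPlus_smul_gen η⟩ : whittakerVectors η) ?_ ?_
  · intro h
    exact gen_ne_zero η (congrArg Subtype.val h)
  · rintro ⟨w, hw⟩
    obtain ⟨a, ha⟩ := mem_span_gen_of_forall_Dp hη fun t => hw (nPlusD t)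
    exact ⟨a, Subtype.ext ha.symm⟩

/-- Root-boundedness of `η` is not needed. -/
theorem isSimpleModule_whittaker (hη : η ≠ 0) : IsSimpleModule Ug (Whittaker η) := by
  have : Nontrivial (Whittaker η) := ⟨⟨gen η, 0, gen_ne_zero η⟩⟩
  refine (isSimpleModule_iff _ _).2 ⟨fun N => ?_⟩
  refine or_iff_not_imp_left.2 fun hN => ?_
  obtain ⟨w, hw, hw0⟩ := N.exists_mem_ne_zero_of_ne_bot hN
  obtain ⟨n, hn⟩ := exists_mem_lexSpan η w
  have hg := gen_mem_of_mem_lexSpan hη N n 0 w hw hw0 hn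
  refine eq_top_iff.2 fun v _ => ?_
  obtain ⟨u, rfl⟩ := exists_smul_gen η v
  exact N.smul_mem _ hg

end

end InsElim

theorem mainTheorem1 (η : InsElim.nPlus →ₗ⁅ℂ⁆ ℂ) (hη : η ≠ 0) (hb : InsElim.RootBounded η) :
    Module.finrank ℂ (InsElim.whittakerVectors η) = 1 ∧
      IsSimpleModule InsElim.Ug (InsElim.Whittaker η) :=
  ⟨InsElim.finrank_whittakerVectors hη, InsElim.isSimpleModule_whittaker hη⟩
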